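/- Setting. Let $\mathbb T=\mathbb Z$ or $\mathbb R$, $\mathbb T^+=\mathbb T\cap[0,\infty)$, let $(\Omega,\mathfrak F,\mathbb P)$ be a probability space, $X$ a real Banach space with a cone $X^+$ (a closed convex set with $\alpha X^+\subset X^+$ for $\alpha\ge 0$ and $X^+\cap(-X^+)=\{0\}$), and let $\Phi=((U_\omega(t))_{\omega\in\Omega,t\in\mathbb T^+},(\theta_t)_{t\in\mathbb T})$ be a measurable linear skew-product semidynamical system on $X$ covering a measurable dynamical system $\theta$ on $\Omega$: $(t,\omega,u)\mapsto U_\omega(t)u$ is jointly measurable, each $U_\omega(t)$ is a bounded linear operator, $U_\omega(0)=\mathrm{Id}$ and $U_{\theta_s\omega}(t)U_\omega(s)=U_\omega(t+s)$. Let $(X^*)^+$ be the set of functionals that are nonnegative on $X^+$, and let $\Phi^*=((U^*_\omega(t)),(\theta_{-t})_{t\in\mathbb T})$, where $U^*_\omega(t)$ is the dual operator of $U_{\theta_{-t}\omega}(t)$. Orders are those induced by the cones. For a system $\Psi=((V_\omega(t)),(\vartheta_t))$ on a Banach space $Y$ with a subset $Y^+$, consider the following assumptions. (A0)(i) $Y^+$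 is a cone, $Y$ is separable, $\dim Y\ge 2$. (A0)(ii) In addition $Y^+$ is normal: there is $C>0$ with $\|u\|\le C\|v\|$ whenever $0\le u\le v$. (A1)(i) $\Psi$ is a measurable linear skew-product semidynamical system, $Y$ is separable, $\vartheta$ is measure preserving and ergodic, and: if $\mathbb T=\mathbb Z$, then $\omega\mapsto\ln^+\|V_\omega(1)\|$ is in $L_1(\mathbb P)$; if $\mathbb T=\mathbb R$, then $\mathbb P$ is complete and $\omega\mapsto\sup_{0\le s\le1}\ln^+\|V_\omega(s)\|$ and $\omega\mapsto\sup_{0\le s\le1}\ln^+\|V_{\vartheta_s\omega}(1-s)\|$ are in $L_1(\mathbb P)$. (A2) (A0)(i) holds, $\Psi$ is a measurable linear skew-product semidynamical system, $\vartheta$ is measure preserving and ergodic, and $u_1\le u_2$ implies $V_\omega(t)u_1\le V_\omega(t)u_2$ for all $\omega\in\Omega$, $t\in\mathbb T^+$. (A3) (A2) holds and there are $\mathbf e\in Y^+$ with $\|\mathbf e\|=1$ and a measurable $\varkappa\colon\Omega\to[1,\infty)$ with $\ln^+\ln\varkappa\in L_1(\mathbb P)$ such that for every $\omega\in\Omega$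 and nonzero $u\in Y^+$ there is $\beta>0$ with $\beta\mathbf e\le V_\omega(1)u\le\varkappa(\omega)\beta\mathbf e$. Write (A0)$^*$–(A3)$^*$, with $\mathbf e^*$ in place of $\mathbf e$, for these assumptions on $\Phi^*$, $X^*$, $(X^*)^+$. The component $C_{\mathbf e}$ consists of the nonzero $v\in Y^+$ with $a\mathbf e\le v\le b\mathbf e$ for some $a,b>0$. An entire orbit of $V_\omega$ is a map $v\colon\mathbb T\to Y$ with $v(s+t)=V_{\vartheta_s\omega}(t)v(s)$ for all $s\in\mathbb T$, $t\in\mathbb T^+$. Theorem. Assume (A0)$^*$(ii), (A1)$^*$(i), (A2)$^*$ and (A3)$^*$. Then there are a measurable set $\tilde\Omega_1^*\subset\Omega$ with $\mathbb P(\tilde\Omega_1^*)=1$ that is invariant ($\theta_t(\tilde\Omega_1^*)=\tilde\Omega_1^*$ for all $t\in\mathbb T$), and a measurable $w^*\colon\tilde\Omega^*_1\to X^*$ with $w^*(\omega)\in C_{\mathbf e^*}$ and $\|w^*(\omega)\|=1$ for all $\omega\in\tilde\Omega_1^*$, such that: (1) $U^*_\omega(t)w^*(\omega)\ne0$ and $w^*(\theta_{-t}\omega)=U^*_\omega(t)w^*(\omega)/\|U^*_\omega(t)w^*(\omega)\|$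 for all $\omega\in\tilde\Omega_1^*$, $t\in\mathbb T^+$. (2) Let $\tilde E^*_1(\omega)=\mathrm{span}\{w^*(\omega)\}$. For $\omega\in\tilde\Omega_1^*$ and $t\in\mathbb T^+$, $U^*_\omega(t)$ maps $\tilde E_1^*(\omega)$ bijectively onto $\tilde E_1^*(\theta_{-t}\omega)$. Put $w^*_\omega(t)=U^*_\omega(t)w^*(\omega)$ for $t\ge0$ and $w^*_\omega(t)=(U^*_{\theta_{-t}\omega}(-t)|_{\tilde E^*_1(\theta_{-t}\omega)})^{-1}w^*(\omega)$ for $t<0$. If $\omega\in\tilde\Omega^*_1$ and $v^*\colon\mathbb T\to(X^*)^+\setminus\{0\}$ is an entire orbit of $U^*_\omega$, then $v^*(t)=\|v^*(0)\|\,w^*_\omega(t)$ for all $t\in\mathbb T$. (3) Let $\rho^*_t(\omega)=\|U^*_\omega(t)w^*(\omega)\|$ for $t\ge0$ and $\rho_t^*(\omega)=1/\|U^*_{\theta_{-t}\omega}(-t)w^*(\theta_{-t}\omega)\|$ for $t<0$. Then $\ln^+\rho_1^*\in L_1(\mathbb P)$, and there is $\tilde\lambda_1^*\in[-\infty,\infty)$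 with $$\tilde\lambda_1^*=\lim_{t\to\pm\infty,\,t\in\mathbb T}\frac1t\ln\rho_t^*(\omega)=\int_\Omega\ln\rho_1^*\,d\mathbb P\qquad\text{for every }\omega\in\tilde\Omega_1^*.$$ (4) If moreover (A0)(ii), (A1)(i), (A2) and (A3) hold for $\Phi$, $X$, $X^+$ and some $\mathbf e$, then there are $\tilde\Omega_1$, $w\colon\tilde\Omega_1\to X$ and $\tilde\lambda_1\in[-\infty,\infty)$ that satisfy for $\Phi$ and $\mathbf e$ all the properties just stated for $\tilde\Omega_1^*$, $w^*$, $\tilde\lambda_1^*$ (with $\theta_t$, $U$, $X^+$ in place of $\theta_{-t}$, $U^*$, $(X^*)^+$), and every such triple satisfies $\tilde\lambda_1=\tilde\lambda_1^*$. -/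

import Mathlib

open Set Filter Topology MeasureTheory

noncomputable section

/-! ## Time sets -/

/-- The time set `𝕋` is either `ℤ` or `ℝ`, seen as an additive subgroup of `ℝ`. -/
class IsTimeSet (𝕋 : AddSubgroup ℝ) : Prop where
  int_or_real : 𝕋 = AddSubgroup.zmultiples (1 : ℝ) ∨ 𝕋 = ⊤

theorem one_mem_timeSet (𝕋 : AddSubgroup ℝ) [h : IsTimeSet 𝕋] : (1 : ℝ) ∈ 𝕋 := by
  rcases h.int_or_real with h | h
  · rw [h]; exact AddSubgroup.mem_zmultiples 1
  · rw [h]; exact AddSubgroup.mem_top 1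

/-- The set `𝕋⁺` of nonnegative times. -/
abbrev NonnegTime (𝕋 : AddSubgroup ℝ) : Type := {t : 𝕋 // 0 ≤ t}

/-- The time `1`, as an element of `𝕋⁺`. -/
def timeOne (𝕋 : AddSubgroup ℝ) [IsTimeSet 𝕋] : NonnegTime 𝕋 :=
  ⟨⟨1, one_mem_timeSet 𝕋⟩, Subtype.coe_le_coe.mp zero_le_one⟩

/-- The nonnegative time `1 - s`, for `0 ≤ s ≤ 1`. -/
def oneSub {𝕋 : AddSubgroup ℝ} [IsTimeSet 𝕋] (s : NonnegTime 𝕋) (hs : s ≤ timeOne 𝕋) :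
    NonnegTime 𝕋 :=
  ⟨(timeOne 𝕋 : 𝕋) - (s : 𝕋), sub_nonneg.mpr hs⟩

/-! ## Metric dynamical systems -/

section Dynamics

variable {𝕋 : AddSubgroup ℝ} {Ω : Type*}

/-- A measurable dynamical system `θ : 𝕋 × Ω → Ω`. -/
structure IsMeasurableDS [MeasurableSpace Ω] (θ : 𝕋 → Ω → Ω) : Prop where
  measurable : Measurable (fun p : 𝕋 × Ω => θ p.1 p.2)
  zero : ∀ ω, θ 0 ω = ω
  add : ∀ (t₁ t₂ : 𝕋) (ω : Ω), θ (t₁ + t₂) ω = θ t₂ (θ t₁ ω)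

/-- `A` is invariant: `θ_t(A) = A` for every `t ∈ 𝕋`. -/
def IsInvariantSet (θ : 𝕋 → Ω → Ω) (A : Set Ω) : Prop :=
  ∀ t : 𝕋, θ t '' A = A

/-- An ergodic metric dynamical system. -/
structure IsErgodicMetricDS [MeasurableSpace Ω] (P : Measure Ω) (θ : 𝕋 → Ω → Ω) : Prop
    extends IsMeasurableDS θ where
  measurePreserving : ∀ t : 𝕋, MeasurePreserving (θ t) P P
  ergodic : ∀ F : Set Ω, MeasurableSet F → IsInvariantSet θ F → P F = 1 ∨ P F = 0

/-- The reversed dynamical system `(θ_{-t})`. -/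
def reverseDS (θ : 𝕋 → Ω → Ω) : 𝕋 → Ω → Ω := fun t => θ (-t)

end Dynamics

/-! ## Measurable linear skew-product semidynamical systems -/

section SkewProduct

variable {𝕋 : AddSubgroup ℝ} {Ω : Type*} [MeasurableSpace Ω]
variable {Y : Type*} [NormedAddCommGroup Y] [NormedSpace ℝ Y]

/-- `V` is a measurable linear skew-product semidynamical system on `Y` covering `θ`. -/
structure IsMLSPS [MeasurableSpace Y] (θ : 𝕋 → Ω → Ω)
    (V : Ω → NonnegTime 𝕋 → (Y →L[ℝ] Y)) : Prop where
  base : IsMeasurableDS θ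
  measurable : Measurable (fun p : NonnegTime 𝕋 × Ω × Y => V p.2.1 p.1 p.2.2)
  identity : ∀ ω, V ω 0 = ContinuousLinearMap.id ℝ Y
  cocycle : ∀ (ω : Ω) (t s : NonnegTime 𝕋),
    (V (θ (s : 𝕋) ω) t).comp (V ω s) = V ω (t + s)

/-- An entire orbit of `V_ω`. -/
def IsEntireOrbit (θ : 𝕋 → Ω → Ω) (V : Ω → NonnegTime 𝕋 → (Y →L[ℝ] Y)) (ω : Ω)
    (v : 𝕋 → Y) : Prop :=
  ∀ (s : 𝕋) (t : NonnegTime 𝕋), v (s + (t : 𝕋)) = V (θ s ω) t (v s)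

end SkewProduct

section Dual

variable {𝕋 : AddSubgroup ℝ} {Ω : Type*}
variable {X : Type*} [NormedAddCommGroup X] [NormedSpace ℝ X]

/-- The dual system: `U*_ω(t)` is the operator on `X*` dual to `U_{θ_{-t}ω}(t)`. -/
def dualSystem (θ : 𝕋 → Ω → Ω) (U : Ω → NonnegTime 𝕋 → (X →L[ℝ] X)) :
    Ω → NonnegTime 𝕋 → (StrongDual ℝ X →L[ℝ] StrongDual ℝ X) :=
  fun ω t => (ContinuousLinearMap.compL ℝ X X ℝ).flip (U (θ (-(t : 𝕋)) ω) t)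

theorem dualSystem_apply (θ : 𝕋 → Ω → Ω) (U : Ω → NonnegTime 𝕋 → (X →L[ℝ] X))
    (ω : Ω) (t : NonnegTime 𝕋) (f : StrongDual ℝ X) (u : X) :
    dualSystem θ U ω t f u = f (U (θ (-(t : 𝕋)) ω) t u) := rfl

/-- The set `(X*)⁺` of functionals that are nonnegative on `X⁺`. -/
def dualCone (K : Set X) : Set (StrongDual ℝ X) := {f | ∀ u ∈ K, 0 ≤ f u}

end Dual

/-! ## Ordered Banach spaces -/

section Order

variable {Y : Type*} [NormedAddCommGroup Y] [NormedSpace ℝ Y]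

/-- A cone: a closed convex set `K` with `αK ⊆ K` for `α ≥ 0` and `K ∩ (-K) = {0}`. -/
structure IsCone (K : Set Y) : Prop where
  isClosed : IsClosed K
  convex : Convex ℝ K
  smul_mem : ∀ α : ℝ, 0 ≤ α → ∀ u ∈ K, α • u ∈ K
  inter_neg : K ∩ {u | -u ∈ K} = {0}

/-- The order `u ≤ v` induced by `K`: `v - u ∈ K`. -/
def coneLE (K : Set Y) (u v : Y) : Prop := v - u ∈ K

/-- The component `C_e` of `e`: the nonzero elements of `K` comparable to `e`. -/
def coneComponent (K : Set Y) (e : Y) : Set Y :=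
  {v | v ∈ K ∧ v ≠ 0 ∧ ∃ a b : ℝ, 0 < a ∧ 0 < b ∧ coneLE K (a • e) v ∧ coneLE K v (b • e)}

/-- The cone `K` is normal. -/
def IsNormalCone (K : Set Y) : Prop :=
  ∃ C : ℝ, 0 < C ∧ ∀ u v : Y, coneLE K 0 u → coneLE K u v → ‖u‖ ≤ C * ‖v‖

/-- `(Y, K)` is an ordered separable Banach space of dimension at least two
(completeness of `Y` is a type class assumption). -/
structure OrderedSeparable (K : Set Y) : Prop where
  cone : IsCone K
  separable : TopologicalSpace.SeparableSpace Y
  two_le_dim : 2 ≤ Module.rank ℝ Y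

/-- `(Y, K)` is a normally ordered separable Banach space of dimension at least two. -/
structure NormallyOrderedSeparable (K : Set Y) : Prop extends OrderedSeparable K where
  normal : IsNormalCone K

end Order

/-! ## Assumptions on a skew-product system -/

section Assumptions

variable {𝕋 : AddSubgroup ℝ} [IsTimeSet 𝕋] {Ω : Type*} [MeasurableSpace Ω]
variable {Y : Type*} [NormedAddCommGroup Y] [NormedSpace ℝ Y] [MeasurableSpace Y]

/-- Integrability assumption. In continuous time the suprema are taken in `[0, ∞]`. -/
structure IntegrableSystem (P : Measure Ω) (θ : 𝕋 → Ω → Ω)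
    (V : Ω → NonnegTime 𝕋 → (Y →L[ℝ] Y)) : Prop where
  mlsps : IsMLSPS θ V
  separable : TopologicalSpace.SeparableSpace Y
  ergodic : IsErgodicMetricDS P θ
  complete : 𝕋 = ⊤ → P.IsComplete
  discrete : 𝕋 = AddSubgroup.zmultiples (1 : ℝ) →
    Integrable (fun ω => Real.posLog ‖V ω (timeOne 𝕋)‖) P
  continuous_left : 𝕋 = ⊤ →
    AEMeasurable (fun ω => ⨆ (s : NonnegTime 𝕋) (_ : s ≤ timeOne 𝕋),
      ENNReal.ofReal (Real.posLog ‖V ω s‖)) P ∧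
    ∫⁻ ω, (⨆ (s : NonnegTime 𝕋) (_ : s ≤ timeOne 𝕋),
      ENNReal.ofReal (Real.posLog ‖V ω s‖)) ∂P < ⊤
  continuous_right : 𝕋 = ⊤ →
    AEMeasurable (fun ω => ⨆ (s : NonnegTime 𝕋) (hs : s ≤ timeOne 𝕋),
      ENNReal.ofReal (Real.posLog ‖V (θ (s : 𝕋) ω) (oneSub s hs)‖)) P ∧
    ∫⁻ ω, (⨆ (s : NonnegTime 𝕋) (hs : s ≤ timeOne 𝕋),
      ENNReal.ofReal (Real.posLog ‖V (θ (s : 𝕋) ω) (oneSub s hs)‖)) ∂P < ⊤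

/-- Positivity assumption. -/
structure PositiveSystem (P : Measure Ω) (θ : 𝕋 → Ω → Ω)
    (V : Ω → NonnegTime 𝕋 → (Y →L[ℝ] Y)) (K : Set Y) : Prop where
  ordered : OrderedSeparable K
  mlsps : IsMLSPS θ V
  ergodic : IsErgodicMetricDS P θ
  monotone : ∀ (ω : Ω) (t : NonnegTime 𝕋) (u₁ u₂ : Y),
    coneLE K u₁ u₂ → coneLE K (V ω t u₁) (V ω t u₂)

/-- Focusing assumption, with the vector `e`. -/
structure FocusingSystem (P : Measure Ω) (θ : 𝕋 → Ω → Ω)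
    (V : Ω → NonnegTime 𝕋 → (Y →L[ℝ] Y)) (K : Set Y) (e : Y) : Prop where
  positive : PositiveSystem P θ V K
  e_mem : e ∈ K
  norm_e : ‖e‖ = 1
  focusing : ∃ κ : Ω → ℝ, Measurable κ ∧ (∀ ω, 1 ≤ κ ω) ∧
    Integrable (fun ω => Real.posLog (Real.log (κ ω))) P ∧
    ∀ (ω : Ω) (u : Y), u ∈ K → u ≠ 0 → ∃ β : ℝ, 0 < β ∧
      coneLE K (β • e) (V ω (timeOne 𝕋) u) ∧
      coneLE K (V ω (timeOne 𝕋) u) ((κ ω * β) • e)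

end Assumptions

/-! ## Principal Floquet subspaces and exponents -/

section Principal

variable {𝕋 : AddSubgroup ℝ} {Ω : Type*}
variable {Y : Type*} [NormedAddCommGroup Y] [NormedSpace ℝ Y]

/-- For `t < 0`, the nonnegative time `-t`. -/
def negTime {t : 𝕋} (ht : ¬ 0 ≤ t) : NonnegTime 𝕋 :=
  ⟨-t, neg_nonneg.mpr (le_of_lt (not_le.mp ht))⟩

/-- The line `E(ω) = span{w(ω)}`. -/
def floquetLine (w : Ω → Y) (ω : Ω) : Set Y := (Submodule.span ℝ {w ω} : Submodule ℝ Y)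

open Classical in
/-- The orbit `w_ω(t)`: equal to `V_ω(t) w(ω)` for `t ≥ 0`, and to
`(V_{θ_t ω}(-t)|_{E(θ_t ω)})⁻¹ w(ω)` for `t < 0`. -/
def floquetOrbit (θ : 𝕋 → Ω → Ω) (V : Ω → NonnegTime 𝕋 → (Y →L[ℝ] Y)) (w : Ω → Y)
    (ω : Ω) (t : 𝕋) : Y :=
  if ht : 0 ≤ t then V ω ⟨t, ht⟩ (w ω)
  else Function.invFunOn (V (θ t ω) (negTime ht)) (floquetLine w (θ t ω)) (w ω)

open Classical in
/-- The growth factor `ρ_t(ω)`: equal to `‖V_ω(t) w(ω)‖` for `t ≥ 0`, and to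
`1 / ‖V_{θ_t ω}(-t) w(θ_t ω)‖` for `t < 0`. -/
def floquetGrowth (θ : 𝕋 → Ω → Ω) (V : Ω → NonnegTime 𝕋 → (Y →L[ℝ] Y)) (w : Ω → Y)
    (t : 𝕋) (ω : Ω) : ℝ :=
  if ht : 0 ≤ t then ‖V ω ⟨t, ht⟩ (w ω)‖
  else 1 / ‖V (θ t ω) (negTime ht) (w (θ t ω))‖

/-- `f` has a well-defined integral `l ∈ [-∞, ∞)`: the positive part of `f` is integrable, and
`l` is the integral of the positive part minus that (possibly `∞`) of the negative part. -/
structure HasExtIntegral [MeasurableSpace Ω] (P : Measure Ω) (f : Ω → ℝ) (l : EReal) : Prop where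
  aemeasurable : AEMeasurable f P
  lintegral_pos_lt_top : ∫⁻ ω, ENNReal.ofReal (f ω) ∂P < ⊤
  eq : l = ((∫⁻ ω, ENNReal.ofReal (f ω) ∂P : ENNReal) : EReal) -
    ((∫⁻ ω, ENNReal.ofReal (-f ω) ∂P : ENNReal) : EReal)

/-- `w`, defined on the invariant set `Ω₁` of full measure, spans the generalized principal
Floquet subspaces of `V`, and `l` is the associated exponent. Values of `w` outside `Ω₁` are
irrelevant. -/
structure IsPrincipalFloquet [IsTimeSet 𝕋] [MeasurableSpace Ω] [MeasurableSpace Y]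
    (P : Measure Ω) (θ : 𝕋 → Ω → Ω) (V : Ω → NonnegTime 𝕋 → (Y →L[ℝ] Y)) (K : Set Y) (e : Y)
    (Ω₁ : Set Ω) (w : Ω → Y) (l : EReal) : Prop where
  invariant : IsInvariantSet θ Ω₁
  measurableSet : MeasurableSet Ω₁
  measure_eq_one : P Ω₁ = 1
  measurable : Measurable (fun ω : Ω₁ => w ω)
  mem_component : ∀ ω ∈ Ω₁, w ω ∈ coneComponent K e
  norm_eq_one : ∀ ω ∈ Ω₁, ‖w ω‖ = 1
  /-- invariance under the normalized cocycle -/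
  normalized : ∀ ω ∈ Ω₁, ∀ t : NonnegTime 𝕋,
    V ω t (w ω) ≠ 0 ∧ w (θ (t : 𝕋) ω) = ‖V ω t (w ω)‖⁻¹ • V ω t (w ω)
  /-- the restriction of `V_ω(t)` to `E(ω)` is a bijection onto `E(θ_t ω)`, so that its inverse
  in the definition of `w_ω(t)` makes sense -/
  bijOn : ∀ ω ∈ Ω₁, ∀ t : NonnegTime 𝕋,
    BijOn (V ω t) (floquetLine w ω) (floquetLine w (θ (t : 𝕋) ω))
  /-- uniqueness of positive entire orbits -/
  orbit_unique : ∀ ω ∈ Ω₁, ∀ v : 𝕋 → Y, (∀ t, v t ∈ K ∧ v t ≠ 0) → IsEntireOrbit θ V ω v →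
    ∀ t : 𝕋, v t = ‖v 0‖ • floquetOrbit θ V w ω t
  /-- the exponent -/
  lt_top : l < ⊤
  tendsto_atTop : ∀ ω ∈ Ω₁, Tendsto
    (fun t : 𝕋 => ((1 / (t : ℝ) * Real.log (floquetGrowth θ V w t ω) : ℝ) : EReal)) atTop (𝓝 l)
  tendsto_atBot : ∀ ω ∈ Ω₁, Tendsto
    (fun t : 𝕋 => ((1 / (t : ℝ) * Real.log (floquetGrowth θ V w t ω) : ℝ) : EReal)) atBot (𝓝 l)
  integral : HasExtIntegral P
    (fun ω => Real.log (floquetGrowth θ V w (timeOne 𝕋 : 𝕋) ω)) l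

end Principal

end

/-!
The theorem is proved for an arbitrary focusing system `(Y, V, K, e)` with a normal cone and then
applied to the given system and to its dual.

*Floquet vectors.* Over one unit of time the operators map the cone into order intervals
`[β e, κ(ω) β e]`, and by Hopf's form of Birkhoff's contraction principle
(`IsFocusingOp.exists_oscillation_le`) each such step shrinks the gap between upper and lower
proportionality factors of two vectors by the factor `1 - 1 / κ(ω)`. By Poincaré recurrence `κ`
stays below some finite level infinitely often in the past of almost every point, so the operators
`V_{θ_{-t} ω}(t)` become almost of rank one as `t → ∞`
(`FocusingSystem.ae_forall_contractsAt`). Normality of the cone turns this into norm convergence of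
directions, uniformly in the initial vector; the common limit is `w(ω)`
(`FocusingSystem.exists_isPullbackLimit`). Invariance of `w` and uniqueness of positive entire
orbits follow from the uniformity. The condition on `ω` is stable under forward time, so it holds
along whole orbits on a set of full measure.

*Exponents.* The logarithm of the growth of `w` is a real additive cocycle. For continuous time the
time-one map need not be ergodic, so instead of Birkhoff's theorem for that map the invariance of
the growth rate under the whole flow is used: the set where the cocycle grows at a rate larger than
`a` is invariant, hence of measure zero or one, and in the latter case the maximal ergodic theorem
(`integral_nonneg_of_ae_exists_birkhoffSum_pos`) makes the integral at least `a`. The unit time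
bounds of the integrability assumption serve to compare real with integer times. A truncation shows
that a rate that is not `-∞` forces integrability, which covers the exponent `-∞`. Negative times
are treated by the reversed cocycle.

*Duality.* Let `c(ω)` be the pairing of the dual Floquet vector with the Floquet vector at `ω`.
Pairing `U_ω(n) w(ω)` with the dual Floquet vector at `θ_n ω` shows that the forward growth of `w`
and the backward growth of the dual Floquet vector at `ω` differ by the factor
`c(ω) / c(θ_n ω)`. Since `c` is positive, Poincaré recurrence keeps `c(θ_n ω)` away from zero
infinitely often, and the exponents agree (`IsPrincipalFloquet.exponent_eq`).
-/

/-! ### The maximal ergodic theorem -/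

section MaximalErgodic

variable {Ω : Type*}

/-- The running maxima `max (0, S₁ f, …, Sₙ f)` of the Birkhoff sums of `f` along `T`, in
recursive form. -/
noncomputable def birkhoffMax (T : Ω → Ω) (f : Ω → ℝ) : ℕ → Ω → ℝ
  | 0 => fun _ => 0
  | n + 1 => fun ω => max 0 (f ω + birkhoffMax T f n (T ω))

theorem birkhoffMax_nonneg (T : Ω → Ω) (f : Ω → ℝ) (n : ℕ) (ω : Ω) :
    0 ≤ birkhoffMax T f n ω := by
  cases n with
  | zero => exact le_rfl
  | succ n => exact le_max_left _ _

theorem birkhoffMax_le_succ (T : Ω → Ω) (f : Ω → ℝ) (n : ℕ) (ω : Ω) :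
    birkhoffMax T f n ω ≤ birkhoffMax T f (n + 1) ω := by
  induction n generalizing ω with
  | zero => exact birkhoffMax_nonneg T f 1 ω
  | succ n ih => exact max_le_max le_rfl (by gcongr; exact ih (T ω))

theorem birkhoffSum_le_birkhoffMax (T : Ω → Ω) (f : Ω → ℝ) (n : ℕ) (ω : Ω) :
    birkhoffSum T f n ω ≤ birkhoffMax T f n ω := by
  induction n generalizing ω with
  | zero => simp [birkhoffMax]
  | succ n ih =>
    rw [birkhoffSum_succ']
    exact le_max_of_le_right (by gcongr; exact ih (T ω))

theorem birkhoffSum_sub_const (T : Ω → Ω) (f : Ω → ℝ) (a : ℝ) (n : ℕ) (ω : Ω) :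
    birkhoffSum T (fun ω => f ω - a) n ω = birkhoffSum T f n ω - n * a := by
  simp [birkhoffSum, Finset.sum_sub_distrib]

variable [MeasurableSpace Ω] {P : Measure Ω}

theorem integrable_birkhoffMax {T : Ω → Ω} (hT : MeasurePreserving T P P) {f : Ω → ℝ}
    (hf : Integrable f P) (n : ℕ) : Integrable (birkhoffMax T f n) P := by
  induction n with
  | zero => exact integrable_zero _ _ _
  | succ n ih =>
    exact (integrable_zero _ _ _).sup (hf.add (hT.integrable_comp_of_integrable ih))

/-- The maximal ergodic theorem, in the case where almost every orbit has a positive Birkhoff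
sum. -/
theorem integral_nonneg_of_ae_exists_birkhoffSum_pos {T : Ω → Ω} (hT : MeasurePreserving T P P)
    {f : Ω → ℝ} (hf : Integrable f P) (h : ∀ᵐ ω ∂P, ∃ k, 0 < birkhoffSum T f k ω) :
    0 ≤ ∫ ω, f ω ∂P := by
  set M := birkhoffMax T f with hM
  -- on `s n` the maximum is attained at a positive time, so that `M n ≤ f + M n ∘ T` there
  set s : ℕ → Set Ω := fun n => {ω | 0 < M n ω} with hs
  have hMi : ∀ n, Integrable (M n) P := fun n => integrable_birkhoffMax hT hf n
  have hsm : ∀ n, NullMeasurableSet (s n) P := fun n =>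
    nullMeasurableSet_lt aemeasurable_const (hMi n).aemeasurable
  have key : ∀ n, 0 ≤ ∫ ω, (s n).indicator f ω ∂P := by
    intro n
    have h1 : ∫ ω, (M n ω - M n (T ω)) ∂P = 0 := by
      rw [integral_sub (hMi n) (g := fun ω => M n (T ω))
        (hT.integrable_comp_of_integrable (hMi n)), sub_eq_zero]
      have := integral_map (μ := P) hT.aemeasurable (f := M n)
        (by rw [hT.map_eq]; exact (hMi n).aestronglyMeasurable)
      rw [hT.map_eq] at this
      exact this
    rw [← h1]
    refine integral_mono ((hMi n).sub (hT.integrable_comp_of_integrable (hMi n)))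
      (hf.indicator₀ (hsm n)) fun ω => ?_
    by_cases hω : ω ∈ s n
    · rw [indicator_of_mem hω]
      cases n with
      | zero => exact absurd (show (0 : ℝ) < 0 from hω) (lt_irrefl _)
      | succ n =>
        have h2 : M (n + 1) ω = f ω + M n (T ω) := by
          have h3 : 0 < max 0 (f ω + M n (T ω)) := hω
          rcases lt_max_iff.1 h3 with h3 | h3
          · exact absurd h3 (lt_irrefl _)
          · exact max_eq_right h3.le
        have := birkhoffMax_le_succ T f n (T ω)
        simp only [h2]
        linarith
    · rw [indicator_of_notMem hω]
      have h2 : M n ω ≤ 0 := not_lt.1 hω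
      have := birkhoffMax_nonneg T f n (T ω)
      linarith
  refine ge_of_tendsto' (tendsto_integral_of_dominated_convergence (fun ω => ‖f ω‖)
    (fun n => (hf.indicator₀ (hsm n)).aestronglyMeasurable) hf.norm
    (fun n => ae_of_all _ fun ω => norm_indicator_le_norm_self _ _) ?_) key
  filter_upwards [h] with ω hω
  obtain ⟨k, hk⟩ := hω
  refine tendsto_const_nhds.congr' ?_
  filter_upwards [eventually_ge_atTop k] with n hn
  have hmono : Monotone fun n => M n ω := monotone_nat_of_le_succ fun n =>
    birkhoffMax_le_succ T f n ω
  have : ω ∈ s n := (hk.trans_le (birkhoffSum_le_birkhoffMax T f k ω)).trans_le (hmono hn)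
  rw [indicator_of_mem this]

theorem le_integral_of_ae_exists_birkhoffSum_gt [IsProbabilityMeasure P] {T : Ω → Ω}
    (hT : MeasurePreserving T P P) {f : Ω → ℝ} (hf : Integrable f P) {a : ℝ}
    (h : ∀ᵐ ω ∂P, ∃ k : ℕ, k * a < birkhoffSum T f k ω) : a ≤ ∫ ω, f ω ∂P := by
  have := integral_nonneg_of_ae_exists_birkhoffSum_pos hT (hf.sub (integrable_const a))
    (by
      filter_upwards [h] with ω ⟨k, hk⟩
      exact ⟨k, by
        have := birkhoffSum_sub_const T f a k ω
        simp only [Pi.sub_def]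
        linarith⟩)
  simp only [Pi.sub_apply] at this
  rw [integral_sub hf (integrable_const a)] at this
  simpa using this

/-- If only the positive part of `f` is integrable, Birkhoff averages that exceed a real number
along almost every orbit force `f` to be integrable. -/
theorem integrable_and_le_integral_of_ae_exists_birkhoffSum_gt [IsProbabilityMeasure P]
    {T : Ω → Ω} (hT : MeasurePreserving T P P) {f : Ω → ℝ} (hfm : Measurable f)
    (hf : ∫⁻ ω, ENNReal.ofReal (f ω) ∂P < ⊤) {a : ℝ}
    (h : ∀ᵐ ω ∂P, ∃ k : ℕ, k * a < birkhoffSum T f k ω) :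
    Integrable f P ∧ a ≤ ∫ ω, f ω ∂P := by
  have hpos : Integrable (fun ω => max (f ω) 0) P := by
    refine ⟨(hfm.max measurable_const).aestronglyMeasurable, ?_⟩
    rw [hasFiniteIntegral_iff_ofReal (ae_of_all _ fun ω => le_max_right (f ω) 0)]
    refine lt_of_le_of_lt (lintegral_mono fun ω => ?_) hf
    rw [ENNReal.ofReal_max]; simp
  -- The truncations `max f (-N)` are integrable and have larger Birkhoff sums.
  set g : ℕ → Ω → ℝ := fun N ω => max (f ω) (-N) with hg
  have hgi : ∀ N, Integrable (g N) P := fun N => by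
    refine (hpos.add (integrable_const (N : ℝ))).mono'
      (hfm.max measurable_const).aestronglyMeasurable (ae_of_all _ fun ω => ?_)
    have hN : (0 : ℝ) ≤ N := N.cast_nonneg
    simp only [hg, Pi.add_apply, Real.norm_eq_abs]
    rw [abs_le]
    constructor
    · have := le_max_right (f ω) (-(N : ℝ)); have := le_max_right (f ω) 0; linarith
    · refine max_le ?_ ?_
      · have := le_max_left (f ω) 0; linarith
      · have := le_max_right (f ω) 0; linarith
  have hga : ∀ N, a ≤ ∫ ω, g N ω ∂P := fun N =>
    le_integral_of_ae_exists_birkhoffSum_gt hT (hgi N) (by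
      filter_upwards [h] with ω ⟨k, hk⟩
      exact ⟨k, hk.trans_le (Finset.sum_le_sum fun i _ => le_max_left _ _)⟩)
  have hneg : ∀ N : ℕ, ∫⁻ ω, ENNReal.ofReal (min (-f ω) N) ∂P ≤
      ENNReal.ofReal (∫ ω, max (f ω) 0 ∂P - a) := by
    intro N
    have h1 : Integrable (fun ω => max (f ω) 0 - g N ω) P := hpos.sub (hgi N)
    refine le_trans (lintegral_mono fun ω => ?_) (b := ∫⁻ ω, ENNReal.ofReal
      (max (f ω) 0 - g N ω) ∂P) ?_
    · refine ENNReal.ofReal_le_ofReal ?_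
      have h2 : min (-f ω) N = - g N ω := by
        simp only [hg, ← min_neg_neg, neg_neg]
      have := le_max_right (f ω) 0
      rw [h2]; linarith
    · rw [← ofReal_integral_eq_lintegral_ofReal h1 (ae_of_all _ fun ω => ?_),
        integral_sub hpos (hgi N)]
      · exact ENNReal.ofReal_le_ofReal (by linarith [hga N])
      · have hN : (0 : ℝ) ≤ N := N.cast_nonneg
        simp only [hg, Pi.zero_apply, sub_nonneg]
        exact max_le_max le_rfl (by linarith)
  have hneg' : ∫⁻ ω, ENNReal.ofReal (-f ω) ∂P ≤ ENNReal.ofReal (∫ ω, max (f ω) 0 ∂P - a) := by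
    have h1 : ∀ ω, ENNReal.ofReal (-f ω) = ⨆ N : ℕ, ENNReal.ofReal (min (-f ω) N) := by
      intro ω
      refine le_antisymm ?_ (iSup_le fun N => ENNReal.ofReal_le_ofReal (min_le_left _ _))
      obtain ⟨N, hN⟩ := exists_nat_ge (-f ω)
      exact le_iSup_of_le N (by rw [min_eq_left hN])
    simp_rw [h1]
    rw [lintegral_iSup (f := fun (N : ℕ) ω => ENNReal.ofReal (min (-f ω) N))
      (fun N => ((hfm.neg.min measurable_const).ennreal_ofReal))]
    · exact iSup_le hneg
    · intro N N' hN ω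
      exact ENNReal.ofReal_le_ofReal (min_le_min le_rfl (by exact_mod_cast hN))
  have hfi : Integrable f P := by
    refine ⟨hfm.aestronglyMeasurable, ?_⟩
    rw [hasFiniteIntegral_iff_norm]
    have h1 : ∀ ω, ENNReal.ofReal ‖f ω‖ ≤ ENNReal.ofReal (f ω) + ENNReal.ofReal (-f ω) := by
      intro ω
      rcases le_total 0 (f ω) with h | h
      · rw [Real.norm_of_nonneg h]; exact le_self_add
      · rw [Real.norm_of_nonpos h]; exact le_add_self
    refine lt_of_le_of_lt (lintegral_mono h1) ?_
    rw [lintegral_add_left hfm.ennreal_ofReal]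
    exact ENNReal.add_lt_top.2 ⟨hf, hneg'.trans_lt ENNReal.ofReal_lt_top⟩
  exact ⟨hfi, le_integral_of_ae_exists_birkhoffSum_gt hT hfi h⟩

/-- Along almost every orbit, an integrable function grows sublinearly. -/
theorem ae_forall_eventually_iterate_le [IsProbabilityMeasure P] {T : Ω → Ω}
    (hT : MeasurePreserving T P P) {F : Ω → ℝ} (hF : Integrable F P) :
    ∀ᵐ ω ∂P, ∀ ε : ℝ, 0 < ε → ∀ᶠ n : ℕ in atTop, F (T^[n] ω) ≤ ε * n := by
  have key : ∀ m : ℕ, ∀ᵐ ω ∂P, ∀ᶠ n : ℕ in atTop, F (T^[n] ω) ≤ (1 / (m + 1 : ℝ)) * n := by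
    intro m
    let _ : MeasureSpace Ω := ⟨P⟩
    have hm : (0 : ℝ) < m + 1 := by positivity
    have h1 := ProbabilityTheory.tsum_prob_mem_Ioi_lt_top (Ω := Ω)
      (X := fun ω => (m + 1 : ℝ) * |F ω|) (hF.abs.const_mul _)
      (fun ω => by simp only [Pi.zero_apply]; positivity)
    have h2 : ∀ j : ℕ, P (T^[j] ⁻¹' {ω | (m + 1 : ℝ) * |F ω| ∈ Ioi (j : ℝ)}) =
        P {ω | (m + 1 : ℝ) * |F ω| ∈ Ioi (j : ℝ)} := fun j =>
      (hT.iterate j).measure_preimage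
        (nullMeasurableSet_lt aemeasurable_const (hF.abs.const_mul _).aemeasurable)
    have h3 : (∑' j : ℕ, P (T^[j] ⁻¹' {ω | (m + 1 : ℝ) * |F ω| ∈ Ioi (j : ℝ)})) ≠ ⊤ := by
      simp_rw [h2]; exact h1.ne
    filter_upwards [ae_eventually_notMem h3] with ω hω
    filter_upwards [hω] with n hn
    have h4 : (m + 1 : ℝ) * |F (T^[n] ω)| ≤ n := not_lt.1 hn
    have h5 := le_abs_self (F (T^[n] ω))
    rw [one_div, inv_mul_eq_div, le_div_iff₀ hm]
    nlinarith
  filter_upwards [ae_all_iff.2 key] with ω hω ε hε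
  obtain ⟨m, hm⟩ := exists_nat_one_div_lt hε
  filter_upwards [hω m] with n hn
  exact hn.trans (by gcongr)

end MaximalErgodic

/-! ### Time sets and invariant sets -/

section TimeSet

variable {𝕋 : AddSubgroup ℝ} [IsTimeSet 𝕋]

/-- The natural number `n`, as an element of `𝕋⁺`. -/
def natTime (𝕋 : AddSubgroup ℝ) [IsTimeSet 𝕋] (n : ℕ) : NonnegTime 𝕋 :=
  ⟨⟨n, by simpa using nsmul_mem (one_mem_timeSet 𝕋) n⟩, Subtype.coe_le_coe.mp n.cast_nonneg⟩

@[simp] theorem coe_natTime (n : ℕ) : (((natTime 𝕋 n : 𝕋)) : ℝ) = n := rfl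

@[simp] theorem coe_timeOne : (((timeOne 𝕋 : 𝕋)) : ℝ) = 1 := rfl

theorem natTime_one : natTime 𝕋 1 = timeOne 𝕋 :=
  Subtype.ext (Subtype.ext Nat.cast_one)

theorem natTime_zero : natTime 𝕋 0 = 0 :=
  Subtype.ext (Subtype.ext Nat.cast_zero)

theorem natTime_add (m n : ℕ) : natTime 𝕋 (m + n) = natTime 𝕋 m + natTime 𝕋 n :=
  Subtype.ext (Subtype.ext (Nat.cast_add m n))

theorem natTime_succ (n : ℕ) : natTime 𝕋 (n + 1) = timeOne 𝕋 + natTime 𝕋 n := by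
  rw [add_comm n 1, natTime_add, natTime_one]

theorem tendsto_coe_timeSet_atTop : Tendsto (fun t : 𝕋 => (t : ℝ)) atTop atTop :=
  tendsto_atTop.2 fun b => by
    obtain ⟨n, hn⟩ := exists_nat_ge b
    filter_upwards [eventually_ge_atTop (natTime 𝕋 n : 𝕋)] with t ht
    exact hn.trans (Subtype.coe_le_coe.mpr ht)

theorem tendsto_natTime_atTop : Tendsto (fun n : ℕ => (natTime 𝕋 n : 𝕋)) atTop atTop :=
  tendsto_atTop.2 fun t => by
    obtain ⟨n, hn⟩ := exists_nat_ge (t : ℝ)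
    filter_upwards [eventually_ge_atTop n] with m hm
    exact Subtype.coe_le_coe.mp (hn.trans (Nat.cast_le.2 hm))

theorem tendsto_floor_timeSet_atTop : Tendsto (fun t : 𝕋 => ⌊(t : ℝ)⌋₊) atTop atTop :=
  tendsto_nat_floor_atTop.comp tendsto_coe_timeSet_atTop

/-- The fractional part of a nonnegative time belongs to `𝕋⁺`. -/
theorem exists_fract_time (t : 𝕋) (ht : 0 ≤ t) :
    ∃ s : NonnegTime 𝕋, s ≤ timeOne 𝕋 ∧ t = (natTime 𝕋 ⌊(t : ℝ)⌋₊ : 𝕋) + (s : 𝕋) := by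
  have h0 : (0 : ℝ) ≤ t := Subtype.coe_le_coe.mpr ht
  refine ⟨⟨t - (natTime 𝕋 ⌊(t : ℝ)⌋₊ : 𝕋), sub_nonneg.2 (Subtype.coe_le_coe.mp ?_)⟩,
    Subtype.coe_le_coe.mp (Subtype.coe_le_coe.mp ?_), by simp⟩
  · exact Nat.floor_le h0
  · have := Nat.lt_floor_add_one (t : ℝ)
    simp only [AddSubgroup.coe_sub, coe_natTime, coe_timeOne]
    linarith

end TimeSet

section Invariant

variable {𝕋 : AddSubgroup ℝ} {Ω : Type*} [MeasurableSpace Ω] {θ : 𝕋 → Ω → Ω}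

theorem IsMeasurableDS.neg_apply (h : IsMeasurableDS θ) (t : 𝕋) (ω : Ω) :
    θ (-t) (θ t ω) = ω := by
  rw [← h.add, add_neg_cancel, h.zero]

theorem IsMeasurableDS.apply_neg (h : IsMeasurableDS θ) (t : 𝕋) (ω : Ω) :
    θ t (θ (-t) ω) = ω := by
  rw [← h.add, neg_add_cancel, h.zero]

theorem IsMeasurableDS.measurable_apply (h : IsMeasurableDS θ) (t : 𝕋) : Measurable (θ t) :=
  h.measurable.comp measurable_prodMk_left

theorem isInvariantSet_iff (h : IsMeasurableDS θ) {A : Set Ω} :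
    IsInvariantSet θ A ↔ ∀ t ω, θ t ω ∈ A ↔ ω ∈ A := by
  constructor
  · intro hA t ω
    refine ⟨fun hω => ?_, fun hω => ?_⟩
    · rw [← hA (-t), ← h.neg_apply t ω]
      exact mem_image_of_mem _ hω
    · rw [← hA t]
      exact mem_image_of_mem _ hω
  · intro hA t
    ext ω
    refine ⟨?_, fun hω => ⟨θ (-t) ω, (hA _ _).2 hω, h.apply_neg t ω⟩⟩
    rintro ⟨ω', hω', rfl⟩
    exact (hA _ _).2 hω'

/-- For invariance it suffices that the set is mapped into itself, since time is reversible. -/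
theorem isInvariantSet_of_forall_mem (h : IsMeasurableDS θ) {A : Set Ω}
    (hA : ∀ t, ∀ ω ∈ A, θ t ω ∈ A) : IsInvariantSet θ A :=
  (isInvariantSet_iff h).2 fun t ω =>
    ⟨fun hω => by simpa [h.neg_apply] using hA (-t) _ hω, hA t ω⟩

theorem IsMeasurableDS.reverse (h : IsMeasurableDS θ) : IsMeasurableDS (reverseDS θ) where
  measurable := h.measurable.comp (measurable_fst.neg.prodMk measurable_snd)
  zero ω := by simp [reverseDS, h.zero]
  add t₁ t₂ ω := by simp only [reverseDS]; rw [← h.add]; congr 1; abel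

variable {P : Measure Ω}

theorem IsErgodicMetricDS.reverse (h : IsErgodicMetricDS P θ) :
    IsErgodicMetricDS P (reverseDS θ) where
  toIsMeasurableDS := h.toIsMeasurableDS.reverse
  measurePreserving t := h.measurePreserving (-t)
  ergodic F hF hi := h.ergodic F hF fun t => by simpa [reverseDS] using hi (-t)

theorem IsMeasurableDS.iterate [IsTimeSet 𝕋] (h : IsMeasurableDS θ) (n : ℕ) (ω : Ω) :
    (θ (timeOne 𝕋 : 𝕋))^[n] ω = θ (natTime 𝕋 n : 𝕋) ω := by
  induction n generalizing ω with
  | zero => rw [natTime_zero]; exact (h.zero ω).symm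
  | succ n ih => rw [Function.iterate_succ_apply, ih, ← h.add, natTime_succ]; rfl

variable [IsTimeSet 𝕋]

/-- An invariant null-measurable set contains an invariant measurable set of the same measure.
For discrete time, a measurable subset of full measure is intersected with its countably many
translates; for continuous time the probability space is complete. -/
theorem exists_measurableSet_invariant_subset (h : IsErgodicMetricDS P θ)
    (hc : 𝕋 = ⊤ → P.IsComplete) {A : Set Ω} (hA : IsInvariantSet θ A)
    (hm : NullMeasurableSet A P) :
    ∃ B ⊆ A, MeasurableSet B ∧ IsInvariantSet θ B ∧ P B = P A := by
  have hds := h.toIsMeasurableDS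
  rcases IsTimeSet.int_or_real (𝕋 := 𝕋) with h𝕋 | h𝕋
  · have hcount : Countable 𝕋 := by
      rw [h𝕋, ← SetLike.coe_sort_coe, AddSubgroup.coe_zmultiples]
      exact (countable_range _).to_subtype
    obtain ⟨A', hsub, hm', hae⟩ := hm.exists_measurable_subset_ae_eq
    have hBA : (⋂ t, θ t ⁻¹' A') ⊆ A' := fun ω hω => by
      have := mem_iInter.1 hω 0
      rwa [mem_preimage, hds.zero] at this
    refine ⟨⋂ t, θ t ⁻¹' A', hBA.trans hsub,
      MeasurableSet.iInter fun t => hds.measurable_apply t hm', ?_, ?_⟩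
    · refine isInvariantSet_of_forall_mem hds fun t ω hω => mem_iInter.2 fun s => ?_
      rw [mem_preimage, ← hds.add]
      exact mem_iInter.1 hω _
    · refine measure_congr ?_
      have h1 : ∀ᵐ ω ∂P, ∀ t, θ t ω ∈ A → θ t ω ∈ A' := by
        refine ae_all_iff.2 fun t => (h.measurePreserving t).quasiMeasurePreserving.ae
          (p := fun ω => ω ∈ A → ω ∈ A') ?_
        exact hae.symm.le
      refine Filter.EventuallyLE.antisymm ?_ ?_
      · exact Eventually.of_forall fun ω hω => hsub (hBA hω)
      · filter_upwards [h1] with ω hω hωA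
        exact mem_iInter.2 fun t => hω t (((isInvariantSet_iff hds).1 hA t ω).2 hωA)
  · have := hc h𝕋
    exact ⟨A, Subset.rfl, hm.measurable_of_complete, hA, rfl⟩

theorem measure_eq_zero_or_one_of_invariant (h : IsErgodicMetricDS P θ)
    (hc : 𝕋 = ⊤ → P.IsComplete) {A : Set Ω} (hA : IsInvariantSet θ A)
    (hm : NullMeasurableSet A P) : P A = 1 ∨ P A = 0 := by
  obtain ⟨B, -, hB, hi, he⟩ := exists_measurableSet_invariant_subset h hc hA hm
  rw [← he]
  exact h.ergodic B hB hi

end Invariant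

/-! ### Growth of additive cocycles -/

section Cocycle

variable {𝕋 : AddSubgroup ℝ} {Ω : Type*}

/-- A real additive cocycle over `θ`. -/
def IsAddCocycle (θ : 𝕋 → Ω → Ω) (φ : 𝕋 → Ω → ℝ) : Prop :=
  ∀ s t ω, φ (s + t) ω = φ t (θ s ω) + φ s ω

theorem IsAddCocycle.neg {θ : 𝕋 → Ω → Ω} {φ : 𝕋 → Ω → ℝ} (h : IsAddCocycle θ φ) :
    IsAddCocycle θ (fun t ω => -φ t ω) := fun s t ω => by
  simp only [h s t ω]; ring

theorem IsAddCocycle.reverse {θ : 𝕋 → Ω → Ω} {φ : 𝕋 → Ω → ℝ} (h : IsAddCocycle θ φ) :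
    IsAddCocycle (reverseDS θ) (fun t ω => -φ (-t) ω) := fun s t ω => by
  simp only [neg_add, h (-s) (-t) ω, reverseDS]

theorem IsAddCocycle.zero [MeasurableSpace Ω] {θ : 𝕋 → Ω → Ω} {φ : 𝕋 → Ω → ℝ}
    (h : IsAddCocycle θ φ) (hds : IsMeasurableDS θ) (ω : Ω) : φ 0 ω = 0 := by
  have := h 0 0 ω
  rw [hds.zero, add_zero] at this
  linarith

/-- Points where `φ` grows at a rate larger than `a`. -/
def fastSet (φ : 𝕋 → Ω → ℝ) (a : ℝ) : Set Ω :=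
  {ω | ∃ b > a, ∃ᶠ t : 𝕋 in atTop, b * t < φ t ω}

/-- `φ t ω` grows at the rate `l`, that is, neither at a rate larger than `l` nor at a smaller
one. For a cocycle `φ`, the invariance of `fastSet φ a` shows in this form that the property
depends on the orbit of `ω` only. -/
def HasGrowthRate (φ : 𝕋 → Ω → ℝ) (l : EReal) (ω : Ω) : Prop :=
  (∀ a : ℝ, l ≤ a → ω ∉ fastSet φ a) ∧
    ∀ a : ℝ, a ≤ l → ω ∉ fastSet (fun t ω => -φ t ω) (-a)

variable {φ : 𝕋 → Ω → ℝ}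

theorem eventually_le_of_notMem_fastSet {a b : ℝ} {ω : Ω} (hω : ω ∉ fastSet φ a) (hb : a < b) :
    ∀ᶠ t : 𝕋 in atTop, φ t ω ≤ b * t := by
  by_contra hcon
  rw [not_eventually] at hcon
  exact hω ⟨b, hb, by simpa using hcon⟩

variable [IsTimeSet 𝕋]

theorem eventually_lt_mul_timeSet (c : ℝ) {ε : ℝ} (hε : 0 < ε) :
    ∀ᶠ t : 𝕋 in atTop, c < ε * t :=
  (tendsto_coe_timeSet_atTop.const_mul_atTop hε).eventually_gt_atTop c

theorem HasGrowthRate.tendsto {l : EReal} {ω : Ω} (h : HasGrowthRate φ l ω) :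
    Tendsto (fun t : 𝕋 => ((1 / (t : ℝ) * φ t ω : ℝ) : EReal)) atTop (𝓝 l) := by
  refine tendsto_order.2 ⟨fun a ha => ?_, fun a ha => ?_⟩
  · obtain ⟨b, hab, hbl⟩ := EReal.lt_iff_exists_real_btwn.1 ha
    obtain ⟨c, hbc, hcl⟩ := EReal.lt_iff_exists_real_btwn.1 hbl
    filter_upwards [eventually_le_of_notMem_fastSet (h.2 c hcl.le)
      (neg_lt_neg (EReal.coe_lt_coe_iff.1 hbc)), tendsto_coe_timeSet_atTop.eventually_gt_atTop 0]
      with t ht ht0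
    refine hab.trans_le (EReal.coe_le_coe_iff.2 ?_)
    rw [one_div, inv_mul_eq_div, le_div_iff₀ ht0]
    linarith
  · obtain ⟨b, hlb, hba⟩ := EReal.lt_iff_exists_real_btwn.1 ha
    obtain ⟨c, hlc, hcb⟩ := EReal.lt_iff_exists_real_btwn.1 hlb
    filter_upwards [eventually_le_of_notMem_fastSet (h.1 c hlc.le)
      (EReal.coe_lt_coe_iff.1 hcb), tendsto_coe_timeSet_atTop.eventually_gt_atTop 0]
      with t ht ht0
    refine lt_of_le_of_lt (EReal.coe_le_coe_iff.2 ?_) hba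
    rw [one_div, inv_mul_eq_div, div_le_iff₀ ht0]
    exact ht

theorem HasGrowthRate.tendsto_atBot {l : EReal} {ω : Ω}
    (h : HasGrowthRate (fun t ω => -φ (-t) ω) l ω) :
    Tendsto (fun t : 𝕋 => ((1 / (t : ℝ) * φ t ω : ℝ) : EReal)) atBot (𝓝 l) := by
  refine (h.tendsto.comp tendsto_neg_atBot_atTop).congr fun t => ?_
  simp only [Function.comp_apply, neg_neg, AddSubgroup.coe_neg]
  congr 1
  ring

variable [MeasurableSpace Ω] {P : Measure Ω} {θ : 𝕋 → Ω → Ω}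

theorem IsAddCocycle.natTime_eq (h : IsAddCocycle θ φ) (hds : IsMeasurableDS θ) (n : ℕ) (ω : Ω) :
    φ (natTime 𝕋 n : 𝕋) ω =
      birkhoffSum (θ (timeOne 𝕋 : 𝕋)) (φ (timeOne 𝕋 : 𝕋)) n ω := by
  induction n generalizing ω with
  | zero => rw [natTime_zero, birkhoffSum_zero]; exact h.zero hds ω
  | succ n ih =>
    rw [birkhoffSum_succ', ← ih, natTime_succ]
    exact (h _ _ ω).trans (add_comm _ _)

theorem measurable_birkhoffSum {T : Ω → Ω} (hT : Measurable T) {f : Ω → ℝ} (hf : Measurable f)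
    (n : ℕ) : Measurable (birkhoffSum T f n) :=
  Finset.measurable_sum _ fun i _ => hf.comp (hT.iterate i)

theorem isInvariantSet_fastSet (h : IsAddCocycle θ φ) (hds : IsMeasurableDS θ) (a : ℝ) :
    IsInvariantSet θ (fastSet φ a) := by
  refine isInvariantSet_of_forall_mem hds fun s ω hω => ?_
  obtain ⟨b, hb, hfr⟩ := hω
  have hb' : a < (a + b) / 2 := by linarith
  refine ⟨(a + b) / 2, hb', ?_⟩
  have hten : Tendsto (fun t : 𝕋 => t + -s) atTop atTop :=
    tendsto_atTop_add_const_right _ _ tendsto_id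
  refine hten.frequently (p := fun t : 𝕋 => (a + b) / 2 * (t : ℝ) < φ t (θ s ω)) ?_
  refine (hfr.and_eventually (eventually_lt_mul_timeSet (φ s ω - (a + b) / 2 * s)
    (show 0 < (b - a) / 2 by linarith))).mono fun t ht => ?_
  obtain ⟨h1, h2⟩ := ht
  have h3 := h s (t + -s) ω
  rw [show s + (t + -s) = t by abel] at h3
  have h4 : ((t + -s : 𝕋) : ℝ) = t - s := by push_cast; ring
  rw [h4]
  linarith

theorem hasGrowthRate_apply_iff (h : IsAddCocycle θ φ) (hds : IsMeasurableDS θ) (l : EReal)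
    (s : 𝕋) (ω : Ω) : HasGrowthRate φ l (θ s ω) ↔ HasGrowthRate φ l ω := by
  unfold HasGrowthRate
  simp only [(isInvariantSet_iff hds).1 (isInvariantSet_fastSet h hds _) s ω,
    (isInvariantSet_iff hds).1 (isInvariantSet_fastSet h.neg hds _) s ω]

/-- A cocycle whose growth rate is detected at integer times either grows at no rate larger than `a`
almost everywhere, or has Birkhoff sums exceeding the rate `a` almost everywhere. -/
theorem ae_le_or_ae_exists_birkhoffSum_gt [IsProbabilityMeasure P] (hθ : IsErgodicMetricDS P θ)
    (hc : 𝕋 = ⊤ → P.IsComplete) (h : IsAddCocycle θ φ) (hm : Measurable (φ (timeOne 𝕋 : 𝕋)))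
    (hφ : ∀ᵐ ω ∂P, ∀ b b' : ℝ, b' < b → (∃ᶠ t : 𝕋 in atTop, b * t < φ t ω) →
      ∃ᶠ n : ℕ in atTop, b' * n < φ (natTime 𝕋 n : 𝕋) ω) (a : ℝ) :
    (∀ᵐ ω ∂P, ω ∉ fastSet φ a) ∨
    (∀ᵐ ω ∂P, ∃ k : ℕ, k * a < birkhoffSum (θ (timeOne 𝕋 : 𝕋)) (φ (timeOne 𝕋 : 𝕋)) k ω) := by
  have hds := hθ.toIsMeasurableDS
  -- a measurable set, defined through integer times, that agrees with `fastSet φ a` up to null sets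
  set B : Set Ω := {ω | ∃ k : ℕ, ∀ N : ℕ, ∃ n : ℕ, N ≤ n ∧
    (a + 1 / (k + 1 : ℝ)) * n < φ (natTime 𝕋 n : 𝕋) ω} with hB
  have hBm : MeasurableSet B := by
    refine measurableSet_setOfPred.2 (Measurable.exists fun k => Measurable.forall fun N =>
      Measurable.exists fun n => Measurable.and measurable_const ?_)
    refine measurableSet_setOfPred.1 (measurableSet_lt measurable_const ?_)
    have h1 : φ (natTime 𝕋 n : 𝕋) = birkhoffSum (θ (timeOne 𝕋 : 𝕋)) (φ (timeOne 𝕋 : 𝕋)) n :=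
      funext fun ω => h.natTime_eq hds n ω
    rw [h1]
    exact measurable_birkhoffSum (hds.measurable_apply _) hm n
  have hBA : B ⊆ fastSet φ a := by
    rintro ω ⟨k, hk⟩
    refine ⟨a + 1 / (k + 1 : ℝ), by simp; positivity, ?_⟩
    exact tendsto_natTime_atTop.frequently (p := fun t : 𝕋 => _ * (t : ℝ) < φ t ω)
      (frequently_atTop.2 hk)
  have hAB : ∀ᵐ ω ∂P, ω ∈ fastSet φ a → ω ∈ B := by
    filter_upwards [hφ] with ω hω hωA
    obtain ⟨b, hb, hfr⟩ := hωA
    obtain ⟨k, hk⟩ := exists_nat_one_div_lt (sub_pos.2 hb)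
    exact ⟨k, frequently_atTop.1 (hω b _ (by linarith) hfr)⟩
  have hae : B =ᵐ[P] fastSet φ a :=
    Filter.EventuallyLE.antisymm (Eventually.of_forall fun ω hω => hBA hω) hAB
  rcases measure_eq_zero_or_one_of_invariant hθ hc (isInvariantSet_fastSet h hds a)
    (hBm.nullMeasurableSet.congr hae) with h1 | h1
  · right
    have h2 : ∀ᵐ ω ∂P, ω ∈ B := by
      rw [← measure_congr hae] at h1
      exact (mem_ae_iff_prob_eq_one hBm).2 h1
    filter_upwards [h2] with ω hω
    obtain ⟨k, hk⟩ := hω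
    obtain ⟨n, hn, hlt⟩ := hk 1
    refine ⟨n, ?_⟩
    rw [← h.natTime_eq hds]
    refine lt_of_le_of_lt ?_ hlt
    rw [mul_comm (n : ℝ)]
    gcongr
    simp; positivity
  · left
    exact measure_eq_zero_iff_ae_notMem.1 h1

/-- The integral of `f` as an extended real number, provided that the positive part of `f` is
integrable. -/
noncomputable def extIntegral (P : Measure Ω) (f : Ω → ℝ) : EReal :=
  ((∫⁻ ω, ENNReal.ofReal (f ω) ∂P : ENNReal) : EReal) -
    ((∫⁻ ω, ENNReal.ofReal (-f ω) ∂P : ENNReal) : EReal)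

theorem extIntegral_eq_integral {f : Ω → ℝ} (hf : Integrable f P) :
    extIntegral P f = ((∫ ω, f ω ∂P : ℝ) : EReal) := by
  rw [integral_eq_lintegral_pos_part_sub_lintegral_neg_part hf, extIntegral]
  have h1 : ∫⁻ ω, ENNReal.ofReal (f ω) ∂P ≠ ⊤ := hf.lintegral_lt_top.ne
  have h2 : ∫⁻ ω, ENNReal.ofReal (-f ω) ∂P ≠ ⊤ := hf.neg.lintegral_lt_top.ne
  rw [EReal.coe_sub, EReal.coe_ennreal_toReal h1, EReal.coe_ennreal_toReal h2]

theorem extIntegral_eq_bot {f : Ω → ℝ} (hfm : Measurable f)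
    (hf : ∫⁻ ω, ENNReal.ofReal (f ω) ∂P < ⊤) (hni : ¬ Integrable f P) :
    extIntegral P f = ⊥ := by
  have h1 : ∫⁻ ω, ENNReal.ofReal (-f ω) ∂P = ⊤ := by
    by_contra hcon
    refine hni ⟨hfm.aestronglyMeasurable, ?_⟩
    rw [hasFiniteIntegral_iff_norm]
    refine lt_of_le_of_lt (lintegral_mono fun ω => ?_)
      (b := ∫⁻ ω, (ENNReal.ofReal (f ω) + ENNReal.ofReal (-f ω)) ∂P) ?_
    · rcases le_total 0 (f ω) with h | h
      · rw [Real.norm_of_nonneg h]; exact le_self_add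
      · rw [Real.norm_of_nonpos h]; exact le_add_self
    · rw [lintegral_add_left hfm.ennreal_ofReal]
      exact ENNReal.add_lt_top.2 ⟨hf, lt_top_iff_ne_top.2 hcon⟩
  rw [extIntegral, h1, EReal.coe_ennreal_top, EReal.sub_top]

theorem extIntegral_lt_top {f : Ω → ℝ} (hfm : Measurable f)
    (hf : ∫⁻ ω, ENNReal.ofReal (f ω) ∂P < ⊤) : extIntegral P f < ⊤ := by
  by_cases hi : Integrable f P
  · rw [extIntegral_eq_integral hi]; exact EReal.coe_lt_top _
  · rw [extIntegral_eq_bot hfm hf hi]; exact bot_lt_top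

/-- The growth rate from above of a cocycle that is bounded above over unit time intervals is
detected at integer times. -/
theorem ae_frequently_natTime_of_le [IsProbabilityMeasure P] (hθ : IsErgodicMetricDS P θ)
    (h : IsAddCocycle θ φ) {F : Ω → ℝ} (hF : Integrable F P)
    (hφF : ∀ᵐ ω ∂P, ∀ s : NonnegTime 𝕋, s ≤ timeOne 𝕋 → φ (s : 𝕋) ω ≤ F ω) :
    ∀ᵐ ω ∂P, ∀ b b' : ℝ, b' < b → (∃ᶠ t : 𝕋 in atTop, b * t < φ t ω) →
      ∃ᶠ n : ℕ in atTop, b' * n < φ (natTime 𝕋 n : 𝕋) ω := by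
  have hds := hθ.toIsMeasurableDS
  have h1 : ∀ᵐ ω ∂P, ∀ n : ℕ, ∀ s : NonnegTime 𝕋, s ≤ timeOne 𝕋 →
      φ (s : 𝕋) (θ (natTime 𝕋 n : 𝕋) ω) ≤ F (θ (natTime 𝕋 n : 𝕋) ω) :=
    ae_all_iff.2 fun n => (hθ.measurePreserving _).quasiMeasurePreserving.ae hφF
  filter_upwards [h1, ae_forall_eventually_iterate_le (hθ.measurePreserving (timeOne 𝕋)) hF]
    with ω hω hsub b b' hb hfr
  have hε : 0 < (b - b') / 2 := by linarith
  -- the increment from time `⌊t⌋` to time `t` is at most `F (θ_⌊t⌋ ω)`, which is sublinear in `t`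
  refine (tendsto_floor_timeSet_atTop (𝕋 := 𝕋)).frequently
    (p := fun n : ℕ => b' * n < φ (natTime 𝕋 n : 𝕋) ω) ?_
  refine (hfr.and_eventually ((tendsto_floor_timeSet_atTop.eventually (hsub _ hε)).and
    ((eventually_ge_atTop (0 : 𝕋)).and (tendsto_floor_timeSet_atTop.eventually
    ((tendsto_natCast_atTop_atTop (R := ℝ)).const_mul_atTop hε |>.eventually_gt_atTop
      |b|))))).mono ?_
  rintro t ⟨ht, h2, h0, h3⟩
  obtain ⟨s, hs, hts⟩ := exists_fract_time t h0
  have hcoc := h (natTime 𝕋 ⌊(t : ℝ)⌋₊ : 𝕋) (s : 𝕋) ω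
  rw [← hts] at hcoc
  have h4 := hω ⌊(t : ℝ)⌋₊ s hs
  rw [hds.iterate] at h2
  have h5 : |b * (t - (⌊(t : ℝ)⌋₊ : ℝ))| ≤ |b| := by
    rw [abs_mul]
    have h6 : |(t - (⌊(t : ℝ)⌋₊ : ℝ))| ≤ 1 := by
      have := Nat.floor_le (show (0 : ℝ) ≤ t from Subtype.coe_le_coe.mpr h0)
      have := Nat.lt_floor_add_one (t : ℝ)
      rw [abs_le]; constructor <;> linarith
    exact mul_le_of_le_one_right (abs_nonneg b) h6
  have h7 := (abs_le.1 h5).1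
  nlinarith

/-- The growth rate from below of a cocycle is detected at integer times, provided that its
increments up to the next integer time are bounded above. -/
theorem ae_frequently_natTime_neg_of_le [IsProbabilityMeasure P] (hθ : IsErgodicMetricDS P θ)
    (h : IsAddCocycle θ φ) {G : Ω → ℝ} (hG : Integrable G P)
    (hφG : ∀ᵐ ω ∂P, ∀ (s : NonnegTime 𝕋) (hs : s ≤ timeOne 𝕋),
      φ (oneSub s hs : 𝕋) (θ (s : 𝕋) ω) ≤ G ω) :
    ∀ᵐ ω ∂P, ∀ b b' : ℝ, b' < b → (∃ᶠ t : 𝕋 in atTop, b * t < -φ t ω) →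
      ∃ᶠ n : ℕ in atTop, b' * n < -φ (natTime 𝕋 n : 𝕋) ω := by
  have hds := hθ.toIsMeasurableDS
  have h1 : ∀ᵐ ω ∂P, ∀ n : ℕ, ∀ (s : NonnegTime 𝕋) (hs : s ≤ timeOne 𝕋),
      φ (oneSub s hs : 𝕋) (θ (s : 𝕋) (θ (natTime 𝕋 n : 𝕋) ω)) ≤ G (θ (natTime 𝕋 n : 𝕋) ω) :=
    ae_all_iff.2 fun n => (hθ.measurePreserving _).quasiMeasurePreserving.ae hφG
  filter_upwards [h1, ae_forall_eventually_iterate_le (hθ.measurePreserving (timeOne 𝕋)) hG]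
    with ω hω hsub b b' hb hfr
  have hε : 0 < (b - b') / 2 := by linarith
  -- the increment from time `t` to time `⌊t⌋ + 1` is at most `G (θ_⌊t⌋ ω)`
  refine ((tendsto_add_atTop_nat 1).comp (tendsto_floor_timeSet_atTop (𝕋 := 𝕋))).frequently
    (p := fun n : ℕ => b' * n < -φ (natTime 𝕋 n : 𝕋) ω) ?_
  refine (hfr.and_eventually ((tendsto_floor_timeSet_atTop.eventually (hsub _ hε)).and
    ((eventually_ge_atTop (0 : 𝕋)).and (tendsto_floor_timeSet_atTop.eventually
    ((tendsto_natCast_atTop_atTop (R := ℝ)).const_mul_atTop hε |>.eventually_gt_atTop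
      (|b| + |b'|)))))).mono ?_
  rintro t ⟨ht, h2, h0, h3⟩
  obtain ⟨s, hs, hts⟩ := exists_fract_time t h0
  have hcoc := h t (oneSub s hs : 𝕋) ω
  have hsum : t + (oneSub s hs : 𝕋) = (natTime 𝕋 (⌊(t : ℝ)⌋₊ + 1) : 𝕋) := by
    rw [natTime_succ]
    change _ = (timeOne 𝕋 : 𝕋) + (natTime 𝕋 ⌊(t : ℝ)⌋₊ : 𝕋)
    nth_rewrite 1 [hts]
    simp only [oneSub]
    abel
  have h4 := hω ⌊(t : ℝ)⌋₊ s hs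
  rw [← hds.add, ← hts] at h4
  rw [hsum] at hcoc
  rw [hds.iterate] at h2
  have h5 : |b * (t - (⌊(t : ℝ)⌋₊ : ℝ))| ≤ |b| := by
    rw [abs_mul]
    have h6 : |(t - (⌊(t : ℝ)⌋₊ : ℝ))| ≤ 1 := by
      have := Nat.floor_le (show (0 : ℝ) ≤ t from Subtype.coe_le_coe.mpr h0)
      have := Nat.lt_floor_add_one (t : ℝ)
      rw [abs_le]; constructor <;> linarith
    exact mul_le_of_le_one_right (abs_nonneg b) h6
  have h7 := (abs_le.1 h5).1
  have h8 := le_abs_self b'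
  simp only [Function.comp_apply, Nat.cast_add, Nat.cast_one]
  nlinarith

/-- The pointwise ergodic theorem for additive cocycles over an ergodic flow that are integrably
bounded above over unit time intervals; the limit may be `-∞`. -/
theorem IsAddCocycle.ae_hasGrowthRate [IsProbabilityMeasure P] (hθ : IsErgodicMetricDS P θ)
    (hc : 𝕋 = ⊤ → P.IsComplete) (h : IsAddCocycle θ φ) (hm : Measurable (φ (timeOne 𝕋 : 𝕋)))
    {F G : Ω → ℝ} (hF : Integrable F P) (hG : Integrable G P)
    (hφF : ∀ᵐ ω ∂P, ∀ s : NonnegTime 𝕋, s ≤ timeOne 𝕋 → φ (s : 𝕋) ω ≤ F ω)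
    (hφG : ∀ᵐ ω ∂P, ∀ (s : NonnegTime 𝕋) (hs : s ≤ timeOne 𝕋),
      φ (oneSub s hs : 𝕋) (θ (s : 𝕋) ω) ≤ G ω) :
    ∀ᵐ ω ∂P, HasGrowthRate φ (extIntegral P (φ (timeOne 𝕋 : 𝕋))) ω := by
  have hT := hθ.measurePreserving (timeOne 𝕋)
  have hpos : ∫⁻ ω, ENNReal.ofReal (φ (timeOne 𝕋 : 𝕋) ω) ∂P < ⊤ := by
    refine lt_of_le_of_lt (lintegral_mono_ae ?_) hF.lintegral_lt_top
    filter_upwards [hφF] with ω hω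
    exact ENNReal.ofReal_le_ofReal (hω _ le_rfl)
  have hup := ae_le_or_ae_exists_birkhoffSum_gt hθ hc h hm
    (ae_frequently_natTime_of_le hθ h hF hφF)
  by_cases hi : Integrable (φ (timeOne 𝕋 : 𝕋)) P
  · rw [extIntegral_eq_integral hi]
    set l := ∫ ω, φ (timeOne 𝕋 : 𝕋) ω ∂P with hl
    have h1 : ∀ᵐ ω ∂P, ∀ n : ℕ, ω ∉ fastSet φ (l + 1 / (n + 1 : ℝ)) := by
      refine ae_all_iff.2 fun n => (hup _).resolve_right fun hcon => ?_
      have := le_integral_of_ae_exists_birkhoffSum_gt hT hi hcon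
      have : (0 : ℝ) < 1 / (n + 1 : ℝ) := by positivity
      linarith
    have h2 : ∀ᵐ ω ∂P, ∀ n : ℕ, ω ∉ fastSet (fun t ω => -φ t ω) (-l + 1 / (n + 1 : ℝ)) := by
      refine ae_all_iff.2 fun n => (ae_le_or_ae_exists_birkhoffSum_gt hθ hc h.neg hm.neg
        (ae_frequently_natTime_neg_of_le hθ h hG hφG) _).resolve_right fun hcon => ?_
      have h3 := le_integral_of_ae_exists_birkhoffSum_gt hT hi.neg hcon
      have : (0 : ℝ) < 1 / (n + 1 : ℝ) := by positivity
      have h4 : ∫ ω, (-φ (timeOne 𝕋 : 𝕋)) ω ∂P = -l := integral_neg _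
      linarith
    filter_upwards [h1, h2] with ω hω1 hω2
    refine ⟨fun a ha hmem => ?_, fun a ha hmem => ?_⟩
    · obtain ⟨b, hb, hfr⟩ := hmem
      have hla := EReal.coe_le_coe_iff.1 ha
      obtain ⟨n, hn⟩ := exists_nat_one_div_lt (sub_pos.2 (hla.trans_lt hb))
      exact hω1 n ⟨b, by linarith, hfr⟩
    · obtain ⟨b, hb, hfr⟩ := hmem
      have hla := EReal.coe_le_coe_iff.1 ha
      obtain ⟨n, hn⟩ := exists_nat_one_div_lt (show 0 < b - -l by linarith)
      exact hω2 n ⟨b, by linarith, hfr⟩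
  · rw [extIntegral_eq_bot hm hpos hi]
    have h1 : ∀ᵐ ω ∂P, ∀ n : ℤ, ω ∉ fastSet φ n := by
      refine ae_all_iff.2 fun n => (hup _).resolve_right fun hcon => ?_
      exact hi (integrable_and_le_integral_of_ae_exists_birkhoffSum_gt hT hm hpos hcon).1
    filter_upwards [h1] with ω hω
    refine ⟨fun a _ hmem => ?_, fun a ha => absurd ha (not_le.2 (EReal.bot_lt_coe a))⟩
    obtain ⟨b, hb, hfr⟩ := hmem
    obtain ⟨n, hn⟩ := exists_int_lt b
    exact hω n ⟨b, hn, hfr⟩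

/-- The pointwise ergodic theorem for additive cocycles in negative time, obtained from the
reversed cocycle. -/
theorem IsAddCocycle.ae_hasGrowthRate_reverse [IsProbabilityMeasure P] (hθ : IsErgodicMetricDS P θ)
    (hc : 𝕋 = ⊤ → P.IsComplete) (h : IsAddCocycle θ φ) (hm : Measurable (φ (timeOne 𝕋 : 𝕋)))
    {F G : Ω → ℝ} (hF : Integrable F P) (hG : Integrable G P)
    (hφF : ∀ᵐ ω ∂P, ∀ s : NonnegTime 𝕋, s ≤ timeOne 𝕋 → φ (s : 𝕋) ω ≤ F ω)
    (hφG : ∀ᵐ ω ∂P, ∀ (s : NonnegTime 𝕋) (hs : s ≤ timeOne 𝕋),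
      φ (oneSub s hs : 𝕋) (θ (s : 𝕋) ω) ≤ G ω) :
    ∀ᵐ ω ∂P, HasGrowthRate (fun t ω => -φ (-t) ω) (extIntegral P (φ (timeOne 𝕋 : 𝕋))) ω := by
  have hds := hθ.toIsMeasurableDS
  have hneg : ∀ t ω, -φ (-t) ω = φ t (θ (-t) ω) := fun t ω => by
    have := h (-t) t ω
    rw [neg_add_cancel, h.zero hds] at this
    linarith
  set one : 𝕋 := (timeOne 𝕋 : 𝕋) with hone
  have hmp := hθ.measurePreserving (-one)
  have hqm := hmp.quasiMeasurePreserving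
  have key := IsAddCocycle.ae_hasGrowthRate (φ := fun t ω => -φ (-t) ω) hθ.reverse hc h.reverse
    (by simp_rw [hneg]; exact hm.comp (hds.measurable_apply _))
    (hmp.integrable_comp_of_integrable hG) (hmp.integrable_comp_of_integrable hF) ?_ ?_
  · have hint : extIntegral P (fun ω => -φ (-one) ω) = extIntegral P (φ one) := by
      simp_rw [hneg, extIntegral]
      rw [hmp.lintegral_comp hm.ennreal_ofReal, hmp.lintegral_comp
        (f := fun ω => ENNReal.ofReal (-φ one ω)) hm.neg.ennreal_ofReal]
    rwa [hint] at key
  · filter_upwards [hqm.ae hφG] with ω hω s hs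
    have h1 := hω (oneSub s hs) (Subtype.coe_le_coe.mp (by
      simp only [oneSub]; exact sub_le_self _ s.2))
    have e1 : ((oneSub (oneSub s hs) (Subtype.coe_le_coe.mp (by
      simp only [oneSub]; exact sub_le_self _ s.2)) : NonnegTime 𝕋) : 𝕋) = s := by simp [oneSub]
    have e2 : -one + (oneSub s hs : 𝕋) = -(s : 𝕋) := by simp only [oneSub, hone]; abel
    rw [← hds.add, e1, e2] at h1
    rw [hneg]
    exact h1
  · filter_upwards [hqm.ae hφF] with ω hω s hs
    have h1 := hω (oneSub s hs) (Subtype.coe_le_coe.mp (by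
      simp only [oneSub]; exact sub_le_self _ s.2))
    have e2 : -(s : 𝕋) + -(oneSub s hs : 𝕋) = -one := by simp only [oneSub, hone]; abel
    rw [hneg, reverseDS, ← hds.add, e2]
    exact h1

end Cocycle

/-! ### Cones and the contraction of order intervals -/

section Cone

variable {Y : Type*} [NormedAddCommGroup Y] {K : Set Y}

theorem coneLE_zero_left {u : Y} : coneLE K 0 u ↔ u ∈ K := by rw [coneLE, sub_zero]

variable [NormedSpace ℝ Y]

theorem IsCone.zero_mem (hK : IsCone K) : (0 : Y) ∈ K := by
  have : (0 : Y) ∈ K ∩ {u | -u ∈ K} := by rw [hK.inter_neg]; rfl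
  exact this.1

theorem IsCone.eq_zero (hK : IsCone K) {u : Y} (h1 : u ∈ K) (h2 : -u ∈ K) : u = 0 := by
  have : u ∈ K ∩ {u | -u ∈ K} := ⟨h1, h2⟩
  rwa [hK.inter_neg] at this

theorem IsCone.add_mem (hK : IsCone K) {u v : Y} (hu : u ∈ K) (hv : v ∈ K) : u + v ∈ K := by
  have := hK.smul_mem 2 zero_le_two _
    (hK.convex hu hv (a := 1 / 2) (b := 1 / 2) (by norm_num) (by norm_num) (by norm_num))
  rwa [smul_add, smul_smul, smul_smul, mul_one_div_cancel two_ne_zero, one_smul, one_smul] at this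

theorem coneLE.trans (hK : IsCone K) {u v w : Y} (h1 : coneLE K u v) (h2 : coneLE K v w) :
    coneLE K u w := by
  have := hK.add_mem h2 h1
  rwa [sub_add_sub_cancel] at this

theorem coneLE.smul (hK : IsCone K) {u v : Y} (h : coneLE K u v) {c : ℝ} (hc : 0 ≤ c) :
    coneLE K (c • u) (c • v) := by
  rw [coneLE, ← smul_sub]
  exact hK.smul_mem c hc _ h

theorem coneLE_smul_smul (hK : IsCone K) {u : Y} (hu : u ∈ K) {a b : ℝ} (h : a ≤ b) :
    coneLE K (a • u) (b • u) := by
  rw [coneLE, ← sub_smul]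
  exact hK.smul_mem _ (sub_nonneg.2 h) _ hu

theorem normalize_mem_cone (hK : IsCone K) {u : Y} (hu : u ∈ K) :
    NormedSpace.normalize u ∈ K :=
  hK.smul_mem _ (inv_nonneg.2 (norm_nonneg u)) _ hu

/-- The operator `L` is positive for the cone `K`; by linearity it is then monotone. -/
def IsMonotoneOp (K : Set Y) (L : Y →L[ℝ] Y) : Prop := ∀ u ∈ K, L u ∈ K

theorem IsMonotoneOp.coneLE {L : Y →L[ℝ] Y} (hL : IsMonotoneOp K L) {u v : Y}
    (h : coneLE K u v) : coneLE K (L u) (L v) := by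
  have := hL _ h
  rwa [map_sub] at this

/-- `L` sends every nonzero element of the cone into the order interval `[β e, κ β e]` for some
`β > 0`. -/
def IsFocusingOp (K : Set Y) (e : Y) (κ : ℝ) (L : Y →L[ℝ] Y) : Prop :=
  ∀ u ∈ K, u ≠ 0 → ∃ β : ℝ, 0 < β ∧ coneLE K (β • e) (L u) ∧ coneLE K (L u) ((κ * β) • e)

/-- Any two elements of the image of the cone under `L` are comparable, with upper and lower
proportionality factors of ratio at most `1 + δ`. -/
def IsAlmostProportional (K : Set Y) (L : Y →L[ℝ] Y) (δ : ℝ) : Prop :=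
  ∀ u ∈ K, u ≠ 0 → ∀ v ∈ K, v ≠ 0 → ∃ a : ℝ, 0 < a ∧ coneLE K (a • L v) (L u) ∧
    coneLE K (L u) ((a * (1 + δ)) • L v)

theorem IsFocusingOp.mono (hK : IsCone K) {e : Y} (he : e ∈ K) {κ κ' : ℝ} {L : Y →L[ℝ] Y}
    (hL : IsFocusingOp K e κ L) (h : κ ≤ κ') : IsFocusingOp K e κ' L := fun u hu hu0 => by
  obtain ⟨β, hβ, h1, h2⟩ := hL u hu hu0
  exact ⟨β, hβ, h1, h2.trans hK (coneLE_smul_smul hK he (by gcongr))⟩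

theorem IsFocusingOp.isAlmostProportional (hK : IsCone K) {e : Y} {κ : ℝ} (hκ : 1 ≤ κ)
    {L : Y →L[ℝ] Y} (hL : IsFocusingOp K e κ L) : IsAlmostProportional K L (κ ^ 2 - 1) := by
  intro u hu hu0 v hv hv0
  obtain ⟨β, hβ, h1, h2⟩ := hL u hu hu0
  obtain ⟨γ, hγ, h3, h4⟩ := hL v hv hv0
  have hκ0 : 0 < κ := by linarith
  have ha : 0 < β / (κ * γ) := by positivity
  refine ⟨β / (κ * γ), ha, ?_, ?_⟩
  · have := h4.smul hK ha.le
    rw [smul_smul, div_mul_cancel₀ _ (by positivity)] at this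
    exact this.trans hK h1
  · have := h3.smul hK (show 0 ≤ κ * β / γ by positivity)
    rw [smul_smul, div_mul_cancel₀ _ (by positivity)] at this
    refine h2.trans hK ?_
    convert! this using 2
    field_simp
    ring

/-- Birkhoff's contraction principle in the form due to Hopf: a focusing operator shrinks the gap
between upper and lower proportionality factors by the factor `1 - 1 / κ`. The two remainders
`u - α v` and `β v - u` are both mapped above positive multiples of `e`, while their sum is mapped
below a comparable multiple of `e`. -/
theorem IsFocusingOp.exists_oscillation_le (hK : IsCone K) {e : Y} {κ : ℝ}
    (hκ : 1 ≤ κ) {L : Y →L[ℝ] Y} (hL : IsFocusingOp K e κ L)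
    {u v : Y} {α β : ℝ} (hαβ : α ≤ β) (h1 : coneLE K (α • v) u)
    (h2 : coneLE K u (β • v)) :
    ∃ α' β' : ℝ, α ≤ α' ∧ β' - α' ≤ (1 - 1 / κ) * (β - α) ∧
      coneLE K (α' • L v) (L u) ∧ coneLE K (L u) (β' • L v) := by
  have hκ0 : 0 < κ := by linarith
  have hκ1 : 0 ≤ 1 - 1 / κ := by
    rw [sub_nonneg, div_le_one hκ0]; exact hκ
  have hgap : 0 ≤ (1 - 1 / κ) * (β - α) := mul_nonneg hκ1 (sub_nonneg.2 hαβ)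
  by_cases hu : u - α • v = 0
  · have : u = α • v := sub_eq_zero.1 hu
    refine ⟨α, α, le_rfl, by simpa using hgap, ?_, ?_⟩ <;>
    · rw [this, map_smul, coneLE, sub_self]; exact hK.zero_mem
  by_cases hv : β • v - u = 0
  · have : u = β • v := (sub_eq_zero.1 hv).symm
    refine ⟨β, β, hαβ, by simpa using hgap, ?_, ?_⟩ <;>
    · rw [this, map_smul, coneLE, sub_self]; exact hK.zero_mem
  obtain ⟨γ, hγ, h3, h4⟩ := hL _ h1 hu
  obtain ⟨δ, hδ, h5, h6⟩ := hL _ h2 hv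
  -- `(β - α) L v` lies below `κ (γ + δ) e`
  have h7 : coneLE K ((β - α) • L v) ((κ * (γ + δ)) • e) := by
    have := hK.add_mem h4 h6
    rw [coneLE]
    convert! this using 1
    simp only [map_sub, map_smul, sub_smul, mul_add, add_smul]
    abel
  have hs : 0 < κ * (γ + δ) := by positivity
  have step : ∀ c : ℝ, 0 < c → coneLE K ((c * (β - α) / (κ * (γ + δ))) • L v) (c • e) := by
    intro c hc
    have := h7.smul hK (show 0 ≤ c / (κ * (γ + δ)) by positivity)
    rw [smul_smul, smul_smul, div_mul_cancel₀ _ hs.ne'] at this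
    rwa [mul_div_right_comm]
  refine ⟨α + γ * (β - α) / (κ * (γ + δ)), β - δ * (β - α) / (κ * (γ + δ)), ?_, ?_, ?_, ?_⟩
  · have : 0 ≤ γ * (β - α) / (κ * (γ + δ)) :=
      div_nonneg (mul_nonneg hγ.le (sub_nonneg.2 hαβ)) hs.le
    linarith
  · refine le_of_eq ?_
    have : γ + δ ≠ 0 := by positivity
    field_simp
    ring
  · have := (step γ hγ).trans hK h3
    rw [coneLE] at this ⊢
    convert! this using 1
    simp only [map_sub, map_smul, add_smul]
    abel
  · have := (step δ hδ).trans hK h5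
    rw [coneLE] at this ⊢
    convert! this using 1
    simp only [map_sub, map_smul, sub_smul]
    abel

theorem IsFocusingOp.comp_isAlmostProportional (hK : IsCone K) {e : Y} {κ : ℝ}
    (hκ : 1 ≤ κ) {L L' : Y →L[ℝ] Y} (hLm : IsMonotoneOp K L) (hLm' : IsMonotoneOp K L')
    (hL : IsFocusingOp K e κ L) {δ : ℝ} (hδ : 0 ≤ δ) (hL' : IsAlmostProportional K L' δ) :
    IsAlmostProportional K (L.comp L') ((1 - 1 / κ) * δ) := by
  intro u hu hu0 v hv hv0
  obtain ⟨a, ha, h1, h2⟩ := hL' u hu hu0 v hv hv0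
  obtain ⟨α', β', h3, h4, h5, h6⟩ := hL.exists_oscillation_le hK hκ
    (le_mul_of_one_le_right ha.le (by linarith)) h1 h2
  refine ⟨α', ha.trans_le h3, h5, coneLE.trans hK h6
    (coneLE_smul_smul hK (hLm _ (hLm' v hv)) ?_)⟩
  have hκ1 : 0 ≤ 1 - 1 / κ := by
    rw [sub_nonneg, div_le_one (by linarith)]; exact hκ
  have h7 : (1 - 1 / κ) * (a * (1 + δ) - a) = a * ((1 - 1 / κ) * δ) := by ring
  have h8 : a * ((1 - 1 / κ) * δ) ≤ α' * ((1 - 1 / κ) * δ) := by gcongr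
  rw [h7] at h4
  linarith

theorem IsAlmostProportional.comp_left {L L' : Y →L[ℝ] Y} {δ : ℝ} (hL : IsMonotoneOp K L)
    (hL' : IsAlmostProportional K L' δ) : IsAlmostProportional K (L.comp L') δ := by
  intro u hu hu0 v hv hv0
  obtain ⟨a, ha, h1, h2⟩ := hL' u hu hu0 v hv hv0
  refine ⟨a, ha, ?_, ?_⟩
  · simpa using hL.coneLE h1
  · simpa using hL.coneLE h2

theorem norm_normalize_sub_le {x y : Y} (hx : x ≠ 0) (hy : ‖y‖ = 1) :
    ‖NormedSpace.normalize x - y‖ ≤ 2 * ‖x - y‖ := by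
  have h1 : ‖NormedSpace.normalize x - x‖ ≤ ‖x - y‖ := by
    have h2 : NormedSpace.normalize x - x = (‖x‖⁻¹ - 1) • x := by
      rw [sub_smul, one_smul]; rfl
    have h3 : 0 < ‖x‖ := norm_pos_iff.2 hx
    rw [h2, norm_smul, Real.norm_eq_abs]
    nth_rewrite 2 [← abs_of_pos h3]
    rw [← abs_mul, sub_mul, inv_mul_cancel₀ h3.ne', one_mul, ← hy, abs_sub_comm]
    exact abs_norm_sub_norm_le _ _
  calc _ = ‖(NormedSpace.normalize x - x) + (x - y)‖ := by rw [sub_add_sub_cancel]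
    _ ≤ _ := norm_add_le _ _
    _ ≤ _ := by linarith

/-- For a normal cone, almost proportional vectors have close directions. -/
theorem IsAlmostProportional.norm_normalize_sub_le {C : ℝ}
    (hC : ∀ u v : Y, coneLE K 0 u → coneLE K u v → ‖u‖ ≤ C * ‖v‖) {L : Y →L[ℝ] Y} {δ : ℝ}
    (hδ : 0 ≤ δ) (hL : IsAlmostProportional K L δ) (hL0 : ∀ u ∈ K, u ≠ 0 → L u ≠ 0)
    {u v : Y} (hu : u ∈ K) (hu0 : u ≠ 0) (hv : v ∈ K) (hv0 : v ≠ 0) :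
    ‖NormedSpace.normalize (L u) - NormedSpace.normalize (L v)‖ ≤ 2 * (C * δ) := by
  obtain ⟨a, ha, h1, h2⟩ := hL u hu hu0 v hv hv0
  have hLv : 0 < ‖L v‖ := norm_pos_iff.2 (hL0 v hv hv0)
  have hc : 0 < (a * ‖L v‖)⁻¹ := by positivity
  have h3 : ‖L u - a • L v‖ ≤ C * (a * δ * ‖L v‖) := by
    have := hC (L u - a • L v) ((a * δ) • L v) (coneLE_zero_left.2 h1) (by
      rw [coneLE] at h2 ⊢
      convert! h2 using 1
      rw [mul_add, add_smul, mul_one]; abel)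
    rwa [norm_smul, Real.norm_of_nonneg (by positivity)] at this
  have h4 : (a * ‖L v‖)⁻¹ • L u - NormedSpace.normalize (L v) =
      (a * ‖L v‖)⁻¹ • (L u - a • L v) := by
    rw [smul_sub, smul_smul, NormedSpace.normalize]
    congr 2
    field_simp
  rw [← NormedSpace.normalize_smul_of_pos hc]
  refine (_root_.norm_normalize_sub_le (smul_ne_zero hc.ne' (hL0 u hu hu0))
    (NormedSpace.norm_normalize (hL0 v hv hv0))).trans ?_
  rw [h4, norm_smul, Real.norm_of_nonneg hc.le]
  refine mul_le_mul_of_nonneg_left ?_ zero_le_two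
  rw [inv_mul_le_iff₀ (by positivity)]
  linarith

end Cone

/-! ### Pullback limits of directions -/

section Pullback

variable {𝕋 : AddSubgroup ℝ} {Ω : Type*}
variable {Y : Type*} [NormedAddCommGroup Y] [NormedSpace ℝ Y]

/-- The operator that transports the fibre over `θ_{-t} ω` to the fibre over `ω`. -/
def pullbackOp (θ : 𝕋 → Ω → Ω) (V : Ω → NonnegTime 𝕋 → (Y →L[ℝ] Y)) (ω : Ω)
    (t : NonnegTime 𝕋) : Y →L[ℝ] Y :=
  V (θ (-(t : 𝕋)) ω) t

/-- Some operator that ends in the fibre over `ω` is almost proportional up to the factor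
`1 + δ`. -/
def ContractsAt (θ : 𝕋 → Ω → Ω) (V : Ω → NonnegTime 𝕋 → (Y →L[ℝ] Y)) (K : Set Y) (δ : ℝ)
    (ω : Ω) : Prop :=
  ∃ t : NonnegTime 𝕋, IsAlmostProportional K (pullbackOp θ V ω t) δ

/-- `w` is the common limit of the directions of vectors of the cone transported to the fibre
over `ω` from the remote past, uniformly in these vectors. -/
def IsPullbackLimit (θ : 𝕋 → Ω → Ω) (V : Ω → NonnegTime 𝕋 → (Y →L[ℝ] Y)) (K : Set Y)
    (ω : Ω) (w : Y) : Prop :=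
  ∀ ε > 0, ∃ t₀ : NonnegTime 𝕋, ∀ t ≥ t₀, ∀ u ∈ K, u ≠ 0 →
    ‖NormedSpace.normalize (pullbackOp θ V ω t u) - w‖ ≤ ε

theorem IsPullbackLimit.tendsto [IsTimeSet 𝕋] {θ : 𝕋 → Ω → Ω}
    {V : Ω → NonnegTime 𝕋 → (Y →L[ℝ] Y)} {K : Set Y} {ω : Ω} {w : Y}
    (h : IsPullbackLimit θ V K ω w) {t : ℕ → NonnegTime 𝕋}
    (ht : ∀ n, natTime 𝕋 n ≤ t n) {u : ℕ → Y} (hu : ∀ n, u n ∈ K) (hu0 : ∀ n, u n ≠ 0) :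
    Tendsto (fun n : ℕ => NormedSpace.normalize (pullbackOp θ V ω (t n) (u n))) atTop (𝓝 w) := by
  refine Metric.tendsto_atTop.2 fun ε hε => ?_
  obtain ⟨t₀, ht₀⟩ := h (ε / 2) (by linarith)
  obtain ⟨N, hN⟩ := exists_nat_ge ((t₀ : 𝕋) : ℝ)
  refine ⟨N, fun n hnN => ?_⟩
  rw [dist_eq_norm]
  have h1 : t₀ ≤ natTime 𝕋 n := hN.trans (Nat.cast_le.2 hnN)
  exact (ht₀ _ (h1.trans (ht n)) _ (hu n) (hu0 n)).trans_lt (by linarith)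

variable [MeasurableSpace Ω] [MeasurableSpace Y] {θ : 𝕋 → Ω → Ω}
  {V : Ω → NonnegTime 𝕋 → (Y →L[ℝ] Y)} {K : Set Y} {e : Y} {P : Measure Ω}

theorem IsMLSPS.apply_add (h : IsMLSPS θ V) (ω : Ω) (t s : NonnegTime 𝕋) (u : Y) :
    V ω (t + s) u = V (θ (s : 𝕋) ω) t (V ω s u) := by
  rw [← h.cocycle]; rfl

theorem IsMLSPS.pullbackOp_apply_add_left (h : IsMLSPS θ V) (ω : Ω) (s t : NonnegTime 𝕋) :
    pullbackOp θ V (θ (s : 𝕋) ω) (s + t) = (V ω s).comp (pullbackOp θ V ω t) := by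
  have h1 : θ (-((s + t : NonnegTime 𝕋) : 𝕋)) (θ (s : 𝕋) ω) = θ (-(t : 𝕋)) ω := by
    rw [← h.base.add]; congr 1; push_cast; abel
  have h2 := h.cocycle (θ (-(t : 𝕋)) ω) s t
  rw [h.base.apply_neg] at h2
  rw [pullbackOp, h1, ← h2]
  rfl

theorem IsMLSPS.pullbackOp_add_right (h : IsMLSPS θ V) (ω : Ω) (t r : NonnegTime 𝕋) :
    pullbackOp θ V ω (t + r) =
      (pullbackOp θ V ω t).comp (V (θ (-((t + r : NonnegTime 𝕋) : 𝕋)) ω) r) := by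
  have h2 := h.cocycle (θ (-((t + r : NonnegTime 𝕋) : 𝕋)) ω) t r
  have h1 : θ (r : 𝕋) (θ (-((t + r : NonnegTime 𝕋) : 𝕋)) ω) = θ (-(t : 𝕋)) ω := by
    rw [← h.base.add]; congr 1; push_cast; abel
  rw [h1] at h2
  rw [pullbackOp, ← h2]
  rfl

/-- An entire orbit is transported to itself. -/
theorem IsEntireOrbit.pullbackOp_apply (h : IsMLSPS θ V) {ω : Ω} {v : 𝕋 → Y}
    (hv : IsEntireOrbit θ V ω v) (s : 𝕋) (t : NonnegTime 𝕋) :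
    pullbackOp θ V (θ s ω) t (v (s - (t : 𝕋))) = v s := by
  have h1 := hv (s - (t : 𝕋)) t
  rw [sub_add_cancel] at h1
  rw [h1, pullbackOp, ← h.base.add, sub_eq_add_neg]

variable [IsTimeSet 𝕋]

theorem exists_natTime_eq_add (t : NonnegTime 𝕋) :
    ∃ (n : ℕ) (r : NonnegTime 𝕋), natTime 𝕋 n = r + t := by
  obtain ⟨n, hn⟩ := exists_nat_ge ((t : 𝕋) : ℝ)
  exact ⟨n, ⟨(natTime 𝕋 n : 𝕋) - (t : 𝕋), sub_nonneg.2 (Subtype.coe_le_coe.mp hn)⟩,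
    Subtype.ext (sub_add_cancel _ _).symm⟩

namespace FocusingSystem

variable (hV : FocusingSystem P θ V K e)
include hV

theorem isCone : IsCone K := hV.positive.ordered.cone

theorem isMLSPS : IsMLSPS θ V := hV.positive.mlsps

theorem isMonotoneOp (ω : Ω) (t : NonnegTime 𝕋) : IsMonotoneOp K (V ω t) := fun u hu => by
  have := hV.positive.monotone ω t 0 u (coneLE_zero_left.2 hu)
  rwa [map_zero, coneLE_zero_left] at this

theorem natTime_apply_ne_zero (ω : Ω) (n : ℕ) {u : Y} (hu : u ∈ K) (hu0 : u ≠ 0) :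
    V ω (natTime 𝕋 n) u ≠ 0 := by
  induction n with
  | zero => rw [natTime_zero, hV.isMLSPS.identity]; exact hu0
  | succ n ih =>
    obtain ⟨κ, -, -, -, hκ⟩ := hV.focusing
    rw [natTime_succ, hV.isMLSPS.apply_add]
    obtain ⟨β, hβ, h1, -⟩ := hκ (θ (natTime 𝕋 n : 𝕋) ω) _ (hV.isMonotoneOp ω _ u hu) ih
    intro h0
    rw [h0, coneLE, zero_sub] at h1
    have h2 := hV.isCone.eq_zero (hV.isCone.smul_mem β hβ.le e hV.e_mem) h1
    have h3 : e ≠ 0 := by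
      have := hV.norm_e
      rintro rfl
      simp at this
    exact smul_ne_zero hβ.ne' h3 h2

/-- At every time, the operators map nonzero elements of the cone to such elements. -/
theorem apply_ne_zero (ω : Ω) (t : NonnegTime 𝕋) {u : Y} (hu : u ∈ K) (hu0 : u ≠ 0) :
    V ω t u ≠ 0 := by
  obtain ⟨n, r, hn⟩ := exists_natTime_eq_add t
  intro h0
  refine hV.natTime_apply_ne_zero ω n hu hu0 ?_
  rw [hn, hV.isMLSPS.apply_add, h0, map_zero]

theorem pullbackOp_mem (ω : Ω) (t : NonnegTime 𝕋) {u : Y} (hu : u ∈ K) :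
    pullbackOp θ V ω t u ∈ K :=
  hV.isMonotoneOp _ t u hu

theorem pullbackOp_ne_zero (ω : Ω) (t : NonnegTime 𝕋) {u : Y} (hu : u ∈ K) (hu0 : u ≠ 0) :
    pullbackOp θ V ω t u ≠ 0 :=
  hV.apply_ne_zero _ t hu hu0

theorem e_ne_zero : e ≠ 0 := norm_ne_zero_iff.1 (hV.norm_e ▸ one_ne_zero)

/-- Contraction persists in forward time, since positive operators preserve proportionality
bounds. -/
theorem contractsAt_apply {δ : ℝ} {ω : Ω} (h : ContractsAt θ V K δ ω) (s : NonnegTime 𝕋) :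
    ContractsAt θ V K δ (θ (s : 𝕋) ω) := by
  obtain ⟨t, ht⟩ := h
  refine ⟨s + t, ?_⟩
  rw [hV.isMLSPS.pullbackOp_apply_add_left]
  exact ht.comp_left (hV.isMonotoneOp ω s)

theorem contractsAt_timeOne_of_focusing {M : ℝ} (hM : 1 ≤ M) {ω : Ω}
    (hω : IsFocusingOp K e M (V ω (timeOne 𝕋))) :
    ContractsAt θ V K (M ^ 2 - 1) (θ (timeOne 𝕋 : 𝕋) ω) := by
  refine ⟨timeOne 𝕋, ?_⟩
  rw [pullbackOp, hV.isMLSPS.base.neg_apply]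
  exact hω.isAlmostProportional hV.isCone hM

theorem contractsAt_timeOne {M δ : ℝ} (hM : 1 ≤ M) (hδ : 0 ≤ δ) {ω : Ω}
    (hω : IsFocusingOp K e M (V ω (timeOne 𝕋))) (h : ContractsAt θ V K δ ω) :
    ContractsAt θ V K ((1 - 1 / M) * δ) (θ (timeOne 𝕋 : 𝕋) ω) := by
  obtain ⟨t, ht⟩ := h
  refine ⟨timeOne 𝕋 + t, ?_⟩
  rw [hV.isMLSPS.pullbackOp_apply_add_left]
  exact hω.comp_isAlmostProportional hV.isCone hM (hV.isMonotoneOp _ _)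
    (fun u hu => hV.pullbackOp_mem ω t hu) hδ ht

/-- If the focusing constant is at most `M` infinitely often in the past of `ω`, then the
contraction gains a factor `1 - 1 / M` infinitely often. -/
theorem contractsAt_of_frequently {M : ℝ} (hM : 1 ≤ M) (j : ℕ) {ω : Ω}
    (hω : ∃ᶠ n : ℕ in atTop, IsFocusingOp K e M (V (θ (-(natTime 𝕋 n : 𝕋)) ω) (timeOne 𝕋))) :
    ContractsAt θ V K ((1 - 1 / M) ^ j * (M ^ 2 - 1)) ω := by
  have hds := hV.isMLSPS.base
  obtain ⟨n, hn, hn1⟩ := (hω.and_eventually (eventually_ge_atTop 1)).exists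
  obtain ⟨m, rfl⟩ : ∃ m, n = m + 1 := ⟨n - 1, by omega⟩
  -- it suffices to treat `θ₁ ω'`, where `ω' = θ_{-(m+1)} ω` is a point with good focusing
  have h1 : θ (natTime 𝕋 m : 𝕋) (θ (timeOne 𝕋 : 𝕋) (θ (-(natTime 𝕋 (m + 1) : 𝕋)) ω)) = ω := by
    rw [← hds.add, ← hds.add, natTime_succ]
    push_cast
    rw [neg_add_cancel, hds.zero]
  rw [← h1]
  refine hV.contractsAt_apply ?_ _
  cases j with
  | zero => rw [pow_zero, one_mul]; exact hV.contractsAt_timeOne_of_focusing hM hn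
  | succ j =>
    rw [pow_succ', mul_assoc]
    have hM1 : 0 ≤ 1 - 1 / M := by
      rw [sub_nonneg, div_le_one (by linarith)]; exact hM
    refine hV.contractsAt_timeOne hM (mul_nonneg (pow_nonneg hM1 j) (by nlinarith)) hn ?_
    refine contractsAt_of_frequently hM j ?_
    refine ((tendsto_sub_atTop_nat (m + 1)).frequently ?_)
    refine (hω.and_eventually (eventually_ge_atTop (m + 1))).mono fun k hk => ?_
    have h2 : θ (-(natTime 𝕋 (k - (m + 1)) : 𝕋)) (θ (-(natTime 𝕋 (m + 1) : 𝕋)) ω) =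
        θ (-(natTime 𝕋 k : 𝕋)) ω := by
      obtain ⟨i, rfl⟩ := Nat.exists_eq_add_of_le hk.2
      rw [← hds.add, Nat.add_sub_cancel_left, natTime_add _ i]
      congr 1; push_cast; abel
    rw [h2]
    exact hk.1

/-- By Poincaré recurrence, the pullback operators contract arbitrarily well at almost every
point. -/
theorem ae_forall_contractsAt [IsFiniteMeasure P] :
    ∀ᵐ ω ∂P, ∀ ε > 0, ∃ δ, 0 ≤ δ ∧ δ ≤ ε ∧ ContractsAt θ V K δ ω := by
  obtain ⟨κ, hκm, hκ1, -, hκ⟩ := hV.focusing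
  have hds := hV.isMLSPS.base
  have hcons := (hV.positive.ergodic.measurePreserving (-(timeOne 𝕋 : 𝕋))).conservative
  have hit : ∀ (n : ℕ) (ω : Ω), (θ (-(timeOne 𝕋 : 𝕋)))^[n] ω = θ (-(natTime 𝕋 n : 𝕋)) ω :=
    fun n ω => hds.reverse.iterate n ω
  have h1 : ∀ᵐ ω ∂P, ∀ M : ℕ, κ ω ≤ M → ∃ᶠ n : ℕ in atTop,
      κ (θ (-(natTime 𝕋 n : 𝕋)) ω) ≤ M := by
    refine ae_all_iff.2 fun M => ?_
    filter_upwards [hcons.ae_mem_imp_frequently_image_mem (s := {ω | κ ω ≤ M})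
      (measurableSet_le hκm measurable_const).nullMeasurableSet] with ω hω hωM
    refine (hω hωM).mono fun n hn => ?_
    rw [hit] at hn
    exact hn
  filter_upwards [h1] with ω hω ε hε
  obtain ⟨M, hM⟩ := exists_nat_ge (κ ω)
  have hM1 : (1 : ℝ) ≤ M := (hκ1 ω).trans hM
  have hfr : ∃ᶠ n : ℕ in atTop,
      IsFocusingOp K e M (V (θ (-(natTime 𝕋 n : 𝕋)) ω) (timeOne 𝕋)) :=
    (hω M hM).mono fun n hn => IsFocusingOp.mono hV.isCone hV.e_mem (hκ _) hn
  have h0 : 0 ≤ 1 - 1 / (M : ℝ) := by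
    rw [sub_nonneg, div_le_one (by linarith)]; exact hM1
  have hlt : 1 - 1 / (M : ℝ) < 1 := by
    have : 0 < 1 / (M : ℝ) := by positivity
    linarith
  have hten : Tendsto (fun j : ℕ => (1 - 1 / (M : ℝ)) ^ j * ((M : ℝ) ^ 2 - 1)) atTop (𝓝 0) := by
    simpa using (tendsto_pow_atTop_nhds_zero_of_lt_one h0 hlt).mul_const ((M : ℝ) ^ 2 - 1)
  obtain ⟨j, hj⟩ := (hten.eventually (ge_mem_nhds hε)).exists
  exact ⟨_, mul_nonneg (pow_nonneg h0 j) (by nlinarith), hj,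
    hV.contractsAt_of_frequently hM1 j hfr⟩

/-- For a normal cone, contraction of the pullback operators makes the transported directions
Cauchy, uniformly in the initial vectors. -/
theorem exists_isPullbackLimit [CompleteSpace Y] (hn : IsNormalCone K) {ω : Ω}
    (hω : ∀ ε > 0, ∃ δ, 0 ≤ δ ∧ δ ≤ ε ∧ ContractsAt θ V K δ ω) :
    ∃ w, IsPullbackLimit θ V K ω w := by
  obtain ⟨C, hC0, hC⟩ := hn
  have hK := hV.isCone
  have key : ∀ ε > 0, ∃ t₀ : NonnegTime 𝕋, ∀ t ≥ t₀, ∀ s ≥ t₀, ∀ u ∈ K, u ≠ 0 →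
      ∀ v ∈ K, v ≠ 0 →
      ‖NormedSpace.normalize (pullbackOp θ V ω t u) -
        NormedSpace.normalize (pullbackOp θ V ω s v)‖ ≤ ε := by
    intro ε hε
    obtain ⟨δ, hδ0, hδ, t₀, ht₀⟩ := hω (ε / (2 * C)) (by positivity)
    -- after a longer time the image of the cone is contained in its image at time `t₀`
    have h1 : ∀ t ≥ t₀, ∀ u ∈ K, u ≠ 0 → ∃ u' ∈ K, u' ≠ 0 ∧
        pullbackOp θ V ω t u = pullbackOp θ V ω t₀ u' := by
      intro t ht u hu hu0
      have h2 : t = t₀ + ⟨(t : 𝕋) - (t₀ : 𝕋), sub_nonneg.2 ht⟩ :=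
        Subtype.ext (add_sub_cancel _ _).symm
      rw [h2, hV.isMLSPS.pullbackOp_add_right]
      exact ⟨_, hV.isMonotoneOp _ _ u hu, hV.apply_ne_zero _ _ hu hu0, rfl⟩
    refine ⟨t₀, fun t ht s hs u hu hu0 v hv hv0 => ?_⟩
    obtain ⟨u', hu', hu0', he⟩ := h1 t ht u hu hu0
    obtain ⟨v', hv', hv0', he'⟩ := h1 s hs v hv hv0
    rw [he, he']
    refine (ht₀.norm_normalize_sub_le hC hδ0 (fun u hu hu0 => hV.pullbackOp_ne_zero ω t₀ hu hu0)
      hu' hu0' hv' hv0').trans ?_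
    rw [le_div_iff₀ (by positivity)] at hδ
    linarith
  have hcau : CauchySeq fun n : ℕ =>
      NormedSpace.normalize (pullbackOp θ V ω (natTime 𝕋 n) e) := by
    refine Metric.cauchySeq_iff'.2 fun ε hε => ?_
    obtain ⟨t₀, ht₀⟩ := key (ε / 2) (by linarith)
    obtain ⟨N, hN⟩ := exists_nat_ge ((t₀ : 𝕋) : ℝ)
    refine ⟨N, fun n hnN => ?_⟩
    rw [dist_eq_norm]
    refine (ht₀ (natTime 𝕋 n) ?_ (natTime 𝕋 N) hN e hV.e_mem hV.e_ne_zero e hV.e_mem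
      hV.e_ne_zero).trans_lt (by linarith)
    exact hN.trans (Nat.cast_le.2 hnN)
  obtain ⟨w, hw⟩ := cauchySeq_tendsto_of_complete hcau
  refine ⟨w, fun ε hε => ?_⟩
  obtain ⟨t₀, ht₀⟩ := key ε hε
  refine ⟨t₀, fun t ht u hu hu0 => ?_⟩
  refine le_of_tendsto (tendsto_const_nhds.sub hw).norm ?_
  obtain ⟨N, hN⟩ := exists_nat_ge ((t₀ : 𝕋) : ℝ)
  filter_upwards [eventually_ge_atTop N] with n hnN
  exact ht₀ t ht _ (hN.trans (Nat.cast_le.2 hnN)) u hu hu0 e hV.e_mem hV.e_ne_zero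

end FocusingSystem

namespace FocusingSystem

variable (hV : FocusingSystem P θ V K e)
include hV

theorem pullbackLimit_mem {ω : Ω} {w : Y} (h : IsPullbackLimit θ V K ω w) : w ∈ K :=
  hV.isCone.isClosed.mem_of_tendsto
    (h.tendsto (fun _ => le_rfl) (fun _ => hV.e_mem) fun _ => hV.e_ne_zero)
    (Eventually.of_forall fun n => normalize_mem_cone hV.isCone
      (hV.pullbackOp_mem ω (natTime 𝕋 n) hV.e_mem))

theorem norm_pullbackLimit {ω : Ω} {w : Y} (h : IsPullbackLimit θ V K ω w) : ‖w‖ = 1 := by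
  refine tendsto_nhds_unique
    (h.tendsto (fun _ => le_rfl) (fun _ => hV.e_mem) fun _ => hV.e_ne_zero).norm ?_
  refine tendsto_const_nhds.congr fun n => ?_
  rw [NormedSpace.norm_normalize (hV.pullbackOp_ne_zero ω _ hV.e_mem hV.e_ne_zero)]

theorem pullbackLimit_ne_zero {ω : Ω} {w : Y} (h : IsPullbackLimit θ V K ω w) : w ≠ 0 :=
  norm_ne_zero_iff.1 (hV.norm_pullbackLimit h ▸ one_ne_zero)

/-- The pullback limits are invariant under the normalized cocycle. -/
theorem pullbackLimit_apply {ω : Ω} {w w' : Y} (h : IsPullbackLimit θ V K ω w)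
    (s : NonnegTime 𝕋) (h' : IsPullbackLimit θ V K (θ (s : 𝕋) ω) w') :
    w' = NormedSpace.normalize (V ω s w) := by
  have hne := hV.apply_ne_zero ω s (hV.pullbackLimit_mem h) (hV.pullbackLimit_ne_zero h)
  have h1 := h.tendsto (fun _ => le_rfl) (fun _ => hV.e_mem) fun _ => hV.e_ne_zero
  have h2 : Tendsto (fun n : ℕ => NormedSpace.normalize (V ω s (NormedSpace.normalize
      (pullbackOp θ V ω (natTime 𝕋 n) e)))) atTop (𝓝 (NormedSpace.normalize (V ω s w))) := by
    have h3 := ((V ω s).continuous.tendsto w).comp h1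
    exact (h3.norm.inv₀ (norm_ne_zero_iff.2 hne)).smul h3
  refine tendsto_nhds_unique ?_ h2
  refine (h'.tendsto (t := fun n => s + natTime 𝕋 n) (fun n => le_add_of_nonneg_left s.2)
    (fun _ => hV.e_mem) fun _ => hV.e_ne_zero).congr fun n => ?_
  have h4 : 0 < ‖pullbackOp θ V ω (natTime 𝕋 n) e‖ :=
    norm_pos_iff.2 (hV.pullbackOp_ne_zero ω _ hV.e_mem hV.e_ne_zero)
  rw [hV.isMLSPS.pullbackOp_apply_add_left, ContinuousLinearMap.comp_apply]
  rw [NormedSpace.normalize.eq_1 (pullbackOp θ V ω (natTime 𝕋 n) e)]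
  rw [map_smul, NormedSpace.normalize_smul_of_pos (inv_pos.2 h4)]

end FocusingSystem

end Pullback

/-! ### Floquet vectors -/

section Floquet

variable {𝕋 : AddSubgroup ℝ} {Ω : Type*}
variable {Y : Type*} [NormedAddCommGroup Y] [NormedSpace ℝ Y]

theorem mem_floquetLine {w : Ω → Y} {ω : Ω} {y : Y} :
    y ∈ floquetLine w ω ↔ ∃ c : ℝ, c • w ω = y :=
  Submodule.mem_span_singleton

/-- A linear operator that maps `w` to a nonzero multiple of `w'` is a bijection between the lines
spanned by these vectors. -/
theorem bijOn_floquetLine {L : Y →L[ℝ] Y} {w : Ω → Y} {ω ω' : Ω} {c : ℝ} (hc : c ≠ 0)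
    (hw' : w ω' ≠ 0) (hL : L (w ω) = c • w ω') :
    BijOn L (floquetLine w ω) (floquetLine w ω') := by
  refine ⟨fun y hy => ?_, fun y hy z hz hyz => ?_, fun y hy => ?_⟩
  · obtain ⟨a, rfl⟩ := mem_floquetLine.1 hy
    exact mem_floquetLine.2 ⟨a * c, by rw [map_smul, hL, smul_smul]⟩
  · obtain ⟨a, rfl⟩ := mem_floquetLine.1 hy
    obtain ⟨b, rfl⟩ := mem_floquetLine.1 hz
    rw [map_smul, map_smul, hL, smul_smul, smul_smul] at hyz
    rw [mul_right_cancel₀ hc (smul_left_injective ℝ hw' hyz)]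
  · obtain ⟨a, rfl⟩ := mem_floquetLine.1 hy
    exact ⟨(a / c) • w ω, mem_floquetLine.2 ⟨_, rfl⟩, by
      rw [map_smul, hL, smul_smul, div_mul_cancel₀ _ hc]⟩

theorem log_norm_apply_le_posLog {L : Y →L[ℝ] Y} {w : Y} (hw : ‖w‖ = 1) :
    Real.log ‖L w‖ ≤ Real.posLog ‖L‖ := by
  refine (le_max_right 0 _).trans (Real.posLog_le_posLog (norm_nonneg _) ?_)
  simpa [hw] using L.le_opNorm w

variable [MeasurableSpace Ω] [MeasurableSpace Y] {θ : 𝕋 → Ω → Ω}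
  {V : Ω → NonnegTime 𝕋 → (Y →L[ℝ] Y)} {K : Set Y} {e : Y} {P : Measure Ω} [IsTimeSet 𝕋]

namespace FocusingSystem

variable (hV : FocusingSystem P θ V K e)
include hV

theorem normalize_timeOne_mem_coneComponent (ω : Ω) {u : Y} (hu : u ∈ K) (hu0 : u ≠ 0) :
    NormedSpace.normalize (V ω (timeOne 𝕋) u) ∈ coneComponent K e := by
  obtain ⟨κ, -, hκ1, -, hκ⟩ := hV.focusing
  obtain ⟨β, hβ, h1, h2⟩ := hκ ω u hu hu0
  have hne := hV.apply_ne_zero ω (timeOne 𝕋) hu hu0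
  have hpos : 0 < ‖V ω (timeOne 𝕋) u‖⁻¹ := inv_pos.2 (norm_pos_iff.2 hne)
  have hκ0 : 0 < κ ω := zero_lt_one.trans_le (hκ1 ω)
  refine ⟨normalize_mem_cone hV.isCone (hV.isMonotoneOp ω _ u hu),
    (NormedSpace.normalize_eq_zero_iff _).not.2 hne, _, _, mul_pos hpos hβ,
    mul_pos hpos (mul_pos hκ0 hβ), ?_, ?_⟩
  · rw [mul_smul]; exact h1.smul hV.isCone hpos.le
  · rw [mul_smul]; exact h2.smul hV.isCone hpos.le

/-- Positive entire orbits point in the direction of the pullback limits. -/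
theorem normalize_entireOrbit {ω : Ω} {v : 𝕋 → Y} (hv : ∀ t, v t ∈ K ∧ v t ≠ 0)
    (hvo : IsEntireOrbit θ V ω v) (s : 𝕋) {w : Y} (hw : IsPullbackLimit θ V K (θ s ω) w) :
    NormedSpace.normalize (v s) = w := by
  refine tendsto_nhds_unique ?_ (hw.tendsto (t := natTime 𝕋) (fun _ => le_rfl)
    (u := fun n => v (s - (natTime 𝕋 n : 𝕋))) (fun n => (hv _).1) fun n => (hv _).2)
  refine tendsto_const_nhds.congr fun n => ?_
  rw [hvo.pullbackOp_apply hV.isMLSPS]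

variable {Ω₁ : Set Ω} {w : Ω → Y} (hΩ : IsInvariantSet θ Ω₁)
  (hw : ∀ ω ∈ Ω₁, IsPullbackLimit θ V K ω (w ω))
include hΩ hw

theorem apply_pullbackLimit {ω : Ω} (hω : ω ∈ Ω₁) (t : NonnegTime 𝕋) :
    V ω t (w ω) ≠ 0 ∧ w (θ (t : 𝕋) ω) = ‖V ω t (w ω)‖⁻¹ • V ω t (w ω) :=
  ⟨hV.apply_ne_zero ω t (hV.pullbackLimit_mem (hw ω hω)) (hV.pullbackLimit_ne_zero (hw ω hω)),
    hV.pullbackLimit_apply (hw ω hω) t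
      (hw _ (((isInvariantSet_iff hV.isMLSPS.base).1 hΩ _ _).2 hω))⟩

theorem apply_pullbackLimit_eq {ω : Ω} (hω : ω ∈ Ω₁) (t : NonnegTime 𝕋) :
    V ω t (w ω) = ‖V ω t (w ω)‖ • w (θ (t : 𝕋) ω) := by
  obtain ⟨h1, h2⟩ := hV.apply_pullbackLimit hΩ hw hω t
  rw [h2, smul_smul, mul_inv_cancel₀ (norm_ne_zero_iff.2 h1), one_smul]

theorem bijOn_pullbackLimit {ω : Ω} (hω : ω ∈ Ω₁) (t : NonnegTime 𝕋) :
    BijOn (V ω t) (floquetLine w ω) (floquetLine w (θ (t : 𝕋) ω)) :=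
  bijOn_floquetLine (norm_ne_zero_iff.2 (hV.apply_pullbackLimit hΩ hw hω t).1)
    (hV.pullbackLimit_ne_zero (hw _ (((isInvariantSet_iff hV.isMLSPS.base).1 hΩ _ _).2 hω)))
    (hV.apply_pullbackLimit_eq hΩ hw hω t)

theorem pullbackLimit_mem_coneComponent {ω : Ω} (hω : ω ∈ Ω₁) : w ω ∈ coneComponent K e := by
  have hds := hV.isMLSPS.base
  set ω' := θ (-(timeOne 𝕋 : 𝕋)) ω with hω'
  have h1 : ω' ∈ Ω₁ := ((isInvariantSet_iff hds).1 hΩ _ _).2 hω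
  have h2 := (hV.apply_pullbackLimit hΩ hw h1 (timeOne 𝕋)).2
  rw [hω', hds.apply_neg] at h2
  rw [h2]
  exact hV.normalize_timeOne_mem_coneComponent _ (hV.pullbackLimit_mem (hw _ h1))
    (hV.pullbackLimit_ne_zero (hw _ h1))

theorem entireOrbit_eq {ω : Ω} (hω : ω ∈ Ω₁) {v : 𝕋 → Y} (hv : ∀ t, v t ∈ K ∧ v t ≠ 0)
    (hvo : IsEntireOrbit θ V ω v) (t : 𝕋) : v t = ‖v 0‖ • floquetOrbit θ V w ω t := by
  have hds := hV.isMLSPS.base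
  have hmem : ∀ s, θ s ω ∈ Ω₁ := fun s => ((isInvariantSet_iff hds).1 hΩ s ω).2 hω
  have hdir : ∀ s, v s = ‖v s‖ • w (θ s ω) := fun s => by
    rw [← hV.normalize_entireOrbit hv hvo s (hw _ (hmem s)), NormedSpace.norm_smul_normalize]
  have h0 : v 0 = ‖v 0‖ • w ω := by simpa only [hds.zero] using hdir 0
  by_cases ht : 0 ≤ t
  · have h1 := hvo 0 ⟨t, ht⟩
    rw [zero_add, hds.zero] at h1
    rw [floquetOrbit, dif_pos ht, ← map_smul, ← h0]
    exact h1
  · rw [floquetOrbit, dif_neg ht]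
    have hbij := hV.bijOn_pullbackLimit hΩ hw (hmem t) (negTime ht)
    have hback : θ ((negTime ht : NonnegTime 𝕋) : 𝕋) (θ t ω) = ω := hds.neg_apply t ω
    rw [hback] at hbij
    have hex := hbij.surjOn (mem_floquetLine.2 ⟨1, one_smul ℝ (w ω)⟩)
    have hmem' := Function.invFunOn_mem hex
    have heq := Function.invFunOn_eq hex
    refine hbij.injOn (mem_floquetLine.2 ⟨_, (hdir t).symm⟩) ?_ ?_
    · obtain ⟨c, hc⟩ := mem_floquetLine.1 hmem'
      rw [← hc, smul_smul]
      exact mem_floquetLine.2 ⟨_, rfl⟩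
    · rw [map_smul, heq, ← h0, ← hvo t (negTime ht)]
      congr 1
      exact add_neg_cancel t

end FocusingSystem

end Floquet

/-! ### The growth cocycle -/

section Growth

variable {𝕋 : AddSubgroup ℝ} {Ω : Type*}

open Classical in
/-- The extension to negative times of a cocycle that is defined over nonnegative times. -/
noncomputable def extendCocycle (θ : 𝕋 → Ω → Ω) (g : NonnegTime 𝕋 → Ω → ℝ) (t : 𝕋) (ω : Ω) :
    ℝ :=
  if ht : 0 ≤ t then g ⟨t, ht⟩ ω else -g (negTime ht) (θ t ω)

theorem extendCocycle_coe (θ : 𝕋 → Ω → Ω) (g : NonnegTime 𝕋 → Ω → ℝ) (t : NonnegTime 𝕋)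
    (ω : Ω) : extendCocycle θ g t ω = g t ω :=
  dif_pos t.2

variable [MeasurableSpace Ω] {θ : 𝕋 → Ω → Ω} {g : NonnegTime 𝕋 → Ω → ℝ}

/-- The extended cocycle at `ω`, computed from a point in the past of `ω`. -/
theorem extendCocycle_eq_sub (hds : IsMeasurableDS θ)
    (hg : ∀ s t ω, g (t + s) ω = g t (θ (s : 𝕋) ω) + g s ω) (t : 𝕋) (ω : Ω)
    (r q : NonnegTime 𝕋) (h : (q : 𝕋) = (r : 𝕋) + t) :
    extendCocycle θ g t ω = g q (θ (-(r : 𝕋)) ω) - g r (θ (-(r : 𝕋)) ω) := by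
  by_cases ht : 0 ≤ t
  · have h1 : q = ⟨t, ht⟩ + r := Subtype.ext (h.trans (add_comm _ _))
    rw [extendCocycle, dif_pos ht, h1, hg, hds.apply_neg, add_sub_cancel_right]
  · have h1 : r = negTime ht + q := by
      refine Subtype.ext ?_
      change (r : 𝕋) = -t + (q : 𝕋)
      rw [h]; abel
    have h2 : θ (q : 𝕋) (θ (-(r : 𝕋)) ω) = θ t ω := by
      rw [← hds.add, h]; congr 1; abel
    have h3 := hg q (negTime ht) (θ (-(r : 𝕋)) ω)
    rw [← h1, h2] at h3
    rw [extendCocycle, dif_neg ht, h3]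
    ring

theorem isAddCocycle_extendCocycle (hds : IsMeasurableDS θ)
    (hg : ∀ s t ω, g (t + s) ω = g t (θ (s : 𝕋) ω) + g s ω) :
    IsAddCocycle θ (extendCocycle θ g) := by
  intro s t ω
  set r : NonnegTime 𝕋 := ⟨|s| + |t|, add_nonneg (abs_nonneg s) (abs_nonneg t)⟩ with hr
  have hs := neg_abs_le s
  have ht := neg_abs_le t
  have h1 : 0 ≤ (r : 𝕋) + s := by
    have := abs_nonneg t
    calc (0 : 𝕋) ≤ (|s| + -|s|) + |t| := by rw [add_neg_cancel, zero_add]; exact this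
      _ ≤ (|s| + s) + |t| := by gcongr
      _ = (r : 𝕋) + s := by simp only [hr]; abel
  have h2 : 0 ≤ (r : 𝕋) + (s + t) := by
    calc (0 : 𝕋) = (|s| + -|s|) + (|t| + -|t|) := by simp
      _ ≤ (|s| + s) + (|t| + t) := by gcongr
      _ = (r : 𝕋) + (s + t) := by simp only [hr]; abel
  rw [extendCocycle_eq_sub hds hg (s + t) ω r ⟨_, h2⟩ rfl,
    extendCocycle_eq_sub hds hg s ω r ⟨_, h1⟩ rfl,
    extendCocycle_eq_sub hds hg t (θ s ω) ⟨_, h1⟩ ⟨_, h2⟩ (add_assoc _ _ _).symm]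
  have h3 : θ (-((r : 𝕋) + s)) (θ s ω) = θ (-(r : 𝕋)) ω := by
    rw [← hds.add]; congr 1; abel
  simp only [h3]
  ring

variable [IsTimeSet 𝕋] {Y : Type*} [NormedAddCommGroup Y] [NormedSpace ℝ Y] [MeasurableSpace Y]
  {V : Ω → NonnegTime 𝕋 → (Y →L[ℝ] Y)} {P : Measure Ω}

/-- Over unit time intervals the logarithmic growth is bounded by integrable functions. -/
theorem IntegrableSystem.exists_integrable_bounds (h : IntegrableSystem P θ V) :
    ∃ F G : Ω → ℝ, Integrable F P ∧ Integrable G P ∧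
      (∀ᵐ ω ∂P, ∀ s : NonnegTime 𝕋, s ≤ timeOne 𝕋 → Real.posLog ‖V ω s‖ ≤ F ω) ∧
      ∀ᵐ ω ∂P, ∀ (s : NonnegTime 𝕋) (hs : s ≤ timeOne 𝕋),
        Real.posLog ‖V (θ (s : 𝕋) ω) (oneSub s hs)‖ ≤ G ω := by
  rcases IsTimeSet.int_or_real (𝕋 := 𝕋) with h𝕋 | h𝕋
  · -- for discrete time, `[0, 1]` contains only the times `0` and `1`
    have hdich : ∀ s : NonnegTime 𝕋, s ≤ timeOne 𝕋 → s = 0 ∨ s = timeOne 𝕋 := by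
      intro s hs
      have h1 : ((s : 𝕋) : ℝ) ∈ AddSubgroup.zmultiples (1 : ℝ) := h𝕋 ▸ (s : 𝕋).2
      obtain ⟨k, hk⟩ := AddSubgroup.mem_zmultiples_iff.1 h1
      rw [zsmul_eq_mul, mul_one] at hk
      have h0 : (0 : ℝ) ≤ ((s : 𝕋) : ℝ) := Subtype.coe_le_coe.mpr s.2
      have h2 : ((s : 𝕋) : ℝ) ≤ 1 := hs
      rw [← hk] at h0 h2
      have hk0 : 0 ≤ k := by exact_mod_cast h0
      have hk1 : k ≤ 1 := by exact_mod_cast h2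
      have : k = 0 ∨ k = 1 := by omega
      rcases this with rfl | rfl
      · left; exact Subtype.ext (Subtype.ext (by rw [← hk]; simp))
      · right; exact Subtype.ext (Subtype.ext (by rw [← hk]; simp))
    have hid : ∀ ω, Real.posLog ‖V ω 0‖ = 0 := by
      intro ω
      rw [h.mlsps.identity, Real.posLog_eq_zero_iff, abs_of_nonneg (norm_nonneg _)]
      exact ContinuousLinearMap.norm_id_le
    refine ⟨_, _, h.discrete h𝕋, h.discrete h𝕋, ae_of_all _ fun ω s hs => ?_,
      ae_of_all _ fun ω s hs => ?_⟩
    · rcases hdich s hs with rfl | rfl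
      · rw [hid]; exact Real.posLog_nonneg
      · exact le_rfl
    · rcases hdich s hs with rfl | rfl
      · have h1 : oneSub (0 : NonnegTime 𝕋) hs = timeOne 𝕋 := Subtype.ext (sub_zero _)
        have h2 : θ ((0 : NonnegTime 𝕋) : 𝕋) ω = ω := h.mlsps.base.zero ω
        rw [h1, h2]
      · have h1 : oneSub (timeOne 𝕋) hs = 0 := Subtype.ext (sub_self _)
        rw [h1, hid]; exact Real.posLog_nonneg
  · obtain ⟨hm1, hf1⟩ := h.continuous_left h𝕋
    obtain ⟨hm2, hf2⟩ := h.continuous_right h𝕋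
    refine ⟨_, _, integrable_toReal_of_lintegral_ne_top hm1 hf1.ne,
      integrable_toReal_of_lintegral_ne_top hm2 hf2.ne, ?_, ?_⟩
    · filter_upwards [ae_lt_top' hm1 hf1.ne] with ω hω s hs
      rw [← ENNReal.toReal_ofReal (Real.posLog_nonneg (x := ‖V ω s‖))]
      exact ENNReal.toReal_mono hω.ne (le_iSup₂_of_le s hs le_rfl)
    · filter_upwards [ae_lt_top' hm2 hf2.ne] with ω hω s hs
      rw [← ENNReal.toReal_ofReal (Real.posLog_nonneg (x := ‖V (θ (s : 𝕋) ω) (oneSub s hs)‖))]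
      exact ENNReal.toReal_mono hω.ne (le_iSup₂_of_le s hs le_rfl)

end Growth

/-! ### Existence of principal Floquet subspaces -/

section Existence

variable {𝕋 : AddSubgroup ℝ} {Ω : Type*} [MeasurableSpace Ω]
variable {Y : Type*} [NormedAddCommGroup Y] [NormedSpace ℝ Y] [MeasurableSpace Y]
variable {θ : 𝕋 → Ω → Ω} {V : Ω → NonnegTime 𝕋 → (Y →L[ℝ] Y)} {K : Set Y} {e : Y}
  {P : Measure Ω}

theorem IsMLSPS.measurable_apply_comp (h : IsMLSPS θ V) (t : NonnegTime 𝕋) {f : Ω → Ω}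
    (hf : Measurable f) {u : Ω → Y} (hu : Measurable u) :
    Measurable fun ω => V (f ω) t (u ω) :=
  h.measurable.comp (measurable_const.prodMk (hf.prodMk hu))

variable [IsTimeSet 𝕋]

/-- The pullback limits exist on an invariant set of full measure and depend measurably on the
base point. -/
theorem FocusingSystem.exists_measurable_pullbackLimit [CompleteSpace Y] [BorelSpace Y]
    [IsProbabilityMeasure P] (hV : FocusingSystem P θ V K e) (hn : IsNormalCone K)
    (hc : 𝕋 = ⊤ → P.IsComplete) :
    ∃ (Ω₀ : Set Ω) (w : Ω → Y), MeasurableSet Ω₀ ∧ IsInvariantSet θ Ω₀ ∧ P Ω₀ = 1 ∧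
      Measurable w ∧ ∀ ω ∈ Ω₀, IsPullbackLimit θ V K ω (w ω) := by
  have hds := hV.isMLSPS.base
  have hsep := hV.positive.ordered.separable
  have : SecondCountableTopology Y := UniformSpace.secondCountable_of_separable Y
  set good : Ω → Prop := fun ω => ∀ ε > 0, ∃ δ, 0 ≤ δ ∧ δ ≤ ε ∧ ContractsAt θ V K δ ω with hgood
  have hfwd : ∀ (s : NonnegTime 𝕋) ω, good ω → good (θ (s : 𝕋) ω) := fun s ω hω ε hε => by
    obtain ⟨δ, h0, h1, h2⟩ := hω ε hε
    exact ⟨δ, h0, h1, hV.contractsAt_apply h2 s⟩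
  set A : Set Ω := {ω | ∀ t, good (θ t ω)} with hA
  have hAi : IsInvariantSet θ A := isInvariantSet_of_forall_mem hds fun t ω hω s => by
    rw [← hds.add]; exact hω _
  have hAae : ∀ᵐ ω ∂P, ω ∈ A := by
    have h1 : ∀ᵐ ω ∂P, ∀ n : ℕ, good (θ (-(natTime 𝕋 n : 𝕋)) ω) :=
      ae_all_iff.2 fun n => (hV.positive.ergodic.measurePreserving _).quasiMeasurePreserving.ae
        hV.ae_forall_contractsAt
    filter_upwards [h1] with ω hω t
    -- every point of the orbit lies in the future of some `θ_{-n} ω`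
    obtain ⟨n, hn⟩ := exists_nat_ge (-(t : ℝ))
    have h2 : 0 ≤ (natTime 𝕋 n : 𝕋) + t := Subtype.coe_le_coe.mp (by
      push_cast; rw [coe_natTime]; linarith)
    have h3 := hfwd ⟨_, h2⟩ _ (hω n)
    rwa [← hds.add, neg_add_cancel_left] at h3
  have hAm : NullMeasurableSet A P :=
    nullMeasurableSet_univ.congr (eventuallyEq_univ.2 hAae).symm
  obtain ⟨Ω₀, hsub, hm, hi, hP⟩ :=
    exists_measurableSet_invariant_subset hV.positive.ergodic hc hAi hAm
  have hP1 : P Ω₀ = 1 := by rw [hP, measure_congr (s := A) (eventuallyEq_univ.2 hAae),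
    measure_univ]
  have hex : ∀ ω ∈ Ω₀, ∃ w, IsPullbackLimit θ V K ω w := fun ω hω => by
    have := hsub hω 0
    rw [hds.zero] at this
    exact hV.exists_isPullbackLimit hn this
  classical
  choose! w₀ hw₀ using hex
  -- the value off `Ω₀` is immaterial; a constant makes `w` measurable on all of `Ω`
  refine ⟨Ω₀, Ω₀.piecewise w₀ fun _ => e, hm, hi, hP1, ?_, fun ω hω => ?_⟩
  · refine measurable_of_tendsto_metrizable (f := fun (n : ℕ) => Ω₀.piecewise (fun ω =>
      NormedSpace.normalize (pullbackOp θ V ω (natTime 𝕋 n) e)) fun _ => e) (fun n => ?_) ?_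
    · have h1 : Measurable fun ω => pullbackOp θ V ω (natTime 𝕋 n) e :=
        hV.isMLSPS.measurable_apply_comp _ (hds.measurable_apply _) measurable_const
      exact Measurable.piecewise hm (h1.norm.inv.smul h1) measurable_const
    · refine tendsto_pi_nhds.2 fun ω => ?_
      by_cases hω : ω ∈ Ω₀
      · simp only [piecewise_eq_of_mem _ _ _ hω]
        exact (hw₀ ω hω).tendsto (fun _ => le_rfl) (fun _ => hV.e_mem) fun _ => hV.e_ne_zero
      · simp only [piecewise_eq_of_notMem _ _ _ hω]
        exact tendsto_const_nhds
  · rw [piecewise_eq_of_mem _ _ _ hω]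
    exact hw₀ ω hω

/-- A focusing system with a normal cone that satisfies the integrability assumption has principal
Floquet subspaces. -/
theorem FocusingSystem.exists_isPrincipalFloquet [CompleteSpace Y] [BorelSpace Y]
    [IsProbabilityMeasure P] (hV : FocusingSystem P θ V K e) (hn : IsNormalCone K)
    (hI : IntegrableSystem P θ V) :
    ∃ (Ω₁ : Set Ω) (w : Ω → Y) (l : EReal), IsPrincipalFloquet P θ V K e Ω₁ w l := by
  have hθ := hV.positive.ergodic
  have hds := hθ.toIsMeasurableDS
  obtain ⟨Ω₀, w, hm, hi, hP, hwm, hw⟩ := hV.exists_measurable_pullbackLimit hn hI.complete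
  have hi' := (isInvariantSet_iff hds).1 hi
  have hΩ₀ : ∀ᵐ ω ∂P, ω ∈ Ω₀ := (mem_ae_iff_prob_eq_one hm).2 hP
  -- the logarithmic growth, set to zero off the invariant set
  set g : NonnegTime 𝕋 → Ω → ℝ := fun t => Ω₀.indicator fun ω => Real.log ‖V ω t (w ω)‖ with hg
  set φ := extendCocycle θ g with hφ
  have hgadd : ∀ s t ω, g (t + s) ω = g t (θ (s : 𝕋) ω) + g s ω := by
    intro s t ω
    by_cases hω : ω ∈ Ω₀
    · have hω' := (hi' (s : 𝕋) ω).2 hω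
      simp only [hg, indicator_of_mem hω, indicator_of_mem hω']
      rw [hV.isMLSPS.apply_add, hV.apply_pullbackLimit_eq hi hw hω s, map_smul, norm_smul,
        norm_norm, Real.log_mul (norm_ne_zero_iff.2 (hV.apply_pullbackLimit hi hw hω s).1)
          (norm_ne_zero_iff.2 (hV.apply_pullbackLimit hi hw hω' t).1), add_comm,
        norm_smul, norm_norm, hV.norm_pullbackLimit (hw _ hω'), mul_one]
    · have hω' := (hi' (s : 𝕋) ω).not.2 hω
      simp only [hg, indicator_of_notMem hω, indicator_of_notMem hω', add_zero]
  have hcoc : IsAddCocycle θ φ := isAddCocycle_extendCocycle hds hgadd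
  have hlogm : Measurable fun ω => Real.log ‖V ω (timeOne 𝕋) (w ω)‖ :=
    Real.measurable_log.comp (hV.isMLSPS.measurable_apply_comp _ measurable_id hwm).norm
  have hφ1 : φ (timeOne 𝕋 : 𝕋) = g (timeOne 𝕋) := funext fun ω => extendCocycle_coe θ g _ ω
  have hφm : Measurable (φ (timeOne 𝕋 : 𝕋)) := by rw [hφ1]; exact hlogm.indicator hm
  have hgle : ∀ t ω, g t ω ≤ Real.posLog ‖V ω t‖ := by
    intro t ω
    by_cases hω : ω ∈ Ω₀
    · simp only [hg, indicator_of_mem hω]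
      exact log_norm_apply_le_posLog (hV.norm_pullbackLimit (hw ω hω))
    · simp only [hg, indicator_of_notMem hω]
      exact Real.posLog_nonneg
  obtain ⟨F, G, hF, hG, hbF, hbG⟩ := hI.exists_integrable_bounds
  have hφF : ∀ᵐ ω ∂P, ∀ s : NonnegTime 𝕋, s ≤ timeOne 𝕋 → φ (s : 𝕋) ω ≤ F ω := by
    filter_upwards [hbF] with ω hω s hs
    rw [hφ, extendCocycle_coe]
    exact (hgle _ _).trans (hω s hs)
  have hφG : ∀ᵐ ω ∂P, ∀ (s : NonnegTime 𝕋) (hs : s ≤ timeOne 𝕋),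
      φ (oneSub s hs : 𝕋) (θ (s : 𝕋) ω) ≤ G ω := by
    filter_upwards [hbG] with ω hω s hs
    rw [hφ, extendCocycle_coe]
    exact (hgle _ _).trans (hω s hs)
  have hpos : ∫⁻ ω, ENNReal.ofReal (φ (timeOne 𝕋 : 𝕋) ω) ∂P < ⊤ := by
    refine lt_of_le_of_lt (lintegral_mono_ae ?_) hF.lintegral_lt_top
    filter_upwards [hφF] with ω hω
    exact ENNReal.ofReal_le_ofReal (hω _ le_rfl)
  set l := extIntegral P (φ (timeOne 𝕋 : 𝕋)) with hl
  have hrate := hcoc.ae_hasGrowthRate hθ hI.complete hφm hF hG hφF hφG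
  have hrate' := hcoc.ae_hasGrowthRate_reverse hθ hI.complete hφm hF hG hφF hφG
  set A : Set Ω := {ω | ω ∈ Ω₀ ∧ HasGrowthRate φ l ω ∧
    HasGrowthRate (fun t ω => -φ (-t) ω) l ω} with hA
  have hAi : IsInvariantSet θ A := isInvariantSet_of_forall_mem hds fun t ω hω =>
    ⟨(hi' t ω).2 hω.1, (hasGrowthRate_apply_iff hcoc hds l t ω).2 hω.2.1, by
      have := (hasGrowthRate_apply_iff hcoc.reverse hds.reverse l (-t) ω).2 hω.2.2
      rwa [reverseDS, neg_neg] at this⟩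
  have hAae : ∀ᵐ ω ∂P, ω ∈ A := by
    filter_upwards [hΩ₀, hrate, hrate'] with ω h1 h2 h3 using ⟨h1, h2, h3⟩
  obtain ⟨Ω₁, hsub, hm₁, hi₁, hP₁⟩ := exists_measurableSet_invariant_subset hθ hI.complete hAi
    (nullMeasurableSet_univ.congr (eventuallyEq_univ.2 hAae).symm)
  have hw₁ : ∀ ω ∈ Ω₁, IsPullbackLimit θ V K ω (w ω) := fun ω hω => hw ω (hsub hω).1
  have hgrowth : ∀ ω ∈ Ω₀, ∀ t, Real.log (floquetGrowth θ V w t ω) = φ t ω := by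
    intro ω hω t
    by_cases ht : 0 ≤ t
    · rw [floquetGrowth, dif_pos ht, hφ, extendCocycle, dif_pos ht]
      simp only [hg, indicator_of_mem hω]
    · rw [floquetGrowth, dif_neg ht, hφ, extendCocycle, dif_neg ht, one_div, Real.log_inv]
      simp only [hg, indicator_of_mem ((hi' t ω).2 hω)]
  have hae : (fun ω => Real.log (floquetGrowth θ V w (timeOne 𝕋 : 𝕋) ω)) =ᵐ[P]
      φ (timeOne 𝕋 : 𝕋) := hΩ₀.mono fun ω hω => hgrowth ω hω _
  refine ⟨Ω₁, w, l, hi₁, hm₁, ?_, hwm.comp measurable_subtype_coe,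
    fun ω hω => hV.pullbackLimit_mem_coneComponent hi₁ hw₁ hω,
    fun ω hω => hV.norm_pullbackLimit (hw₁ ω hω),
    fun ω hω t => hV.apply_pullbackLimit hi₁ hw₁ hω t,
    fun ω hω t => hV.bijOn_pullbackLimit hi₁ hw₁ hω t,
    fun ω hω v hv hvo t => hV.entireOrbit_eq hi₁ hw₁ hω hv hvo t,
    extIntegral_lt_top hφm hpos, fun ω hω => ?_, fun ω hω => ?_, ?_⟩
  · rw [hP₁, measure_congr (s := A) (eventuallyEq_univ.2 hAae), measure_univ]
  · simp_rw [hgrowth ω (hsub hω).1]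
    exact (hsub hω).2.1.tendsto
  · simp_rw [hgrowth ω (hsub hω).1]
    exact (hsub hω).2.2.tendsto_atBot
  · refine ⟨hφm.aemeasurable.congr hae.symm, ?_, ?_⟩
    · exact (lintegral_congr_ae (hae.fun_comp ENNReal.ofReal)).trans_lt hpos
    · exact congrArg₂ (fun a b : ENNReal => (a : EReal) - (b : EReal))
        (lintegral_congr_ae (hae.fun_comp ENNReal.ofReal)).symm
        (lintegral_congr_ae (hae.fun_comp fun x => ENNReal.ofReal (-x))).symm

end Existence

/-! ### Duality of the exponents -/

section Duality

theorem coneComponent_dual_apply_pos {X : Type*} [NormedAddCommGroup X] [NormedSpace ℝ X]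
    {K : Set X} {e w : X} {e' w' : StrongDual ℝ X}
    (he : e' ∈ dualCone K) (hpos : 0 < e' e) (hw : w ∈ coneComponent K e)
    (hw' : w' ∈ coneComponent (dualCone K) e') : 0 < w' w := by
  obtain ⟨hwK, -, a, -, ha, -, h1, -⟩ := hw
  obtain ⟨-, -, a', -, ha', -, h2, -⟩ := hw'
  have h3 := h2 w hwK
  have h4 := he _ h1
  rw [map_sub, map_smul, smul_eq_mul] at h4
  rw [sub_apply, smul_apply, smul_eq_mul] at h3
  have h5 : 0 < a * e' e := mul_pos ha hpos
  nlinarith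

variable {𝕋 : AddSubgroup ℝ} [IsTimeSet 𝕋] {Ω : Type*} [MeasurableSpace Ω] {P : Measure Ω}
variable {X : Type*} [NormedAddCommGroup X] [NormedSpace ℝ X] [MeasurableSpace X]
variable {θ : 𝕋 → Ω → Ω} {U : Ω → NonnegTime 𝕋 → (X →L[ℝ] X)} {K : Set X} {e : X}
  {e' : StrongDual ℝ X}

/-- The focusing vectors of a system and of its dual pair to a positive number: otherwise `e'`
would vanish on the images of `U`, hence `U* e'`, and with it `e'`, would vanish on the cone. -/
theorem FocusingSystem.dual_apply_pos [Nonempty Ω] (hU : FocusingSystem P θ U K e)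
    (hU' : FocusingSystem P (reverseDS θ) (dualSystem θ U) (dualCone K) e') : 0 < e' e := by
  refine lt_of_le_of_ne (hU'.e_mem e hU.e_mem) fun h0 => hU'.e_ne_zero ?_
  obtain ⟨ω⟩ := ‹Nonempty Ω›
  obtain ⟨κ', -, -, -, hκ'⟩ := hU'.focusing
  obtain ⟨κ, -, -, -, hκ⟩ := hU.focusing
  obtain ⟨β', hβ', h1, -⟩ := hκ' ω e' hU'.e_mem hU'.e_ne_zero
  refine hU'.isCone.eq_zero hU'.e_mem fun u hu => ?_
  by_cases hu0 : u = 0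
  · simp [hu0]
  obtain ⟨β, hβ, -, h2⟩ := hκ (θ (-(timeOne 𝕋 : 𝕋)) ω) u hu hu0
  have h3 := hU'.e_mem _ h2
  have h4 := h1 u hu
  rw [map_sub, map_smul, ← h0, smul_zero, zero_sub] at h3
  rw [sub_apply, dualSystem_apply, smul_apply,
    smul_eq_mul] at h4
  rw [neg_apply]
  nlinarith

theorem measurable_indicator_of_subtype {Y : Type*} [MeasurableSpace Y] [Zero Y] {s : Set Ω}
    (hs : MeasurableSet s) {f : Ω → Y} (hf : Measurable fun ω : s => f ω) :
    Measurable (s.indicator f) := by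
  refine measurable_of_restrict_of_restrict_compl hs ?_ ?_
  · rwa [show s.domRestrict (s.indicator f) = fun ω : s => f ω from
      funext fun ω => indicator_of_mem ω.2 f]
  · rw [show sᶜ.domRestrict (s.indicator f) = fun _ => 0 from
      funext fun ω => indicator_of_notMem ω.2 f]
    exact measurable_const

theorem IsPrincipalFloquet.apply_eq {Y : Type*} [NormedAddCommGroup Y] [NormedSpace ℝ Y]
    [MeasurableSpace Y] {θ : 𝕋 → Ω → Ω} {V : Ω → NonnegTime 𝕋 → (Y →L[ℝ] Y)} {K : Set Y} {e : Y}
    {Ω₁ : Set Ω} {w : Ω → Y} {l : EReal} (h : IsPrincipalFloquet P θ V K e Ω₁ w l) {ω : Ω}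
    (hω : ω ∈ Ω₁) (t : NonnegTime 𝕋) : V ω t (w ω) = ‖V ω t (w ω)‖ • w (θ (t : 𝕋) ω) := by
  obtain ⟨h1, h2⟩ := h.normalized ω hω t
  rw [h2, smul_smul, mul_inv_cancel₀ (norm_ne_zero_iff.2 h1), one_smul]

/-- Pairing the orbit of the Floquet vector with the dual Floquet vectors in two ways. -/
theorem IsPrincipalFloquet.norm_mul_pairing_eq (hds : IsMeasurableDS θ)
    {Ω₁ Ω' : Set Ω} {w : Ω → X} {w' : Ω → StrongDual ℝ X} {l l' : EReal}
    (h : IsPrincipalFloquet P θ U K e Ω₁ w l)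
    (h' : IsPrincipalFloquet P (reverseDS θ) (dualSystem θ U) (dualCone K) e' Ω' w' l')
    {ω : Ω} (hω : ω ∈ Ω₁) (hω' : ω ∈ Ω') (t : NonnegTime 𝕋) :
    ‖U ω t (w ω)‖ * w' (θ (t : 𝕋) ω) (w (θ (t : 𝕋) ω)) =
      ‖dualSystem θ U (θ (t : 𝕋) ω) t (w' (θ (t : 𝕋) ω))‖ * w' ω (w ω) := by
  have hmem : θ (t : 𝕋) ω ∈ Ω' := by
    rw [← h'.invariant (-(t : 𝕋))]
    exact ⟨ω, hω', by rw [reverseDS, neg_neg]⟩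
  have h1 := congrArg (fun f : StrongDual ℝ X => f (w ω)) (h'.apply_eq hmem t)
  have h2 : reverseDS θ (t : 𝕋) (θ (t : 𝕋) ω) = ω := hds.neg_apply _ _
  simp only [dualSystem_apply, h2, hds.neg_apply, smul_apply,
    smul_eq_mul] at h1
  rw [← h1, ← smul_eq_mul, ← map_smul, ← h.apply_eq hω t]

/-- The exponents of a system and of its dual agree. Forward growth of the Floquet vector at `ω`
and backward growth of the dual Floquet vector at `ω` differ by the ratio of the pairings at `ω`
and at `θ_n ω`, and by Poincaré recurrence the latter is infinitely often bounded away from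
zero. -/
theorem IsPrincipalFloquet.exponent_eq [IsProbabilityMeasure P] [BorelSpace X]
    [TopologicalSpace.SeparableSpace X]
    (hθ : IsErgodicMetricDS P θ) {Ω₁ Ω' : Set Ω} {w : Ω → X} {w' : Ω → StrongDual ℝ X}
    {l l' : EReal} (h : IsPrincipalFloquet P θ U K e Ω₁ w l)
    (h' : IsPrincipalFloquet P (reverseDS θ) (dualSystem θ U) (dualCone K) e' Ω' w' l')
    (he : e' ∈ dualCone K) (hpos : 0 < e' e) : l = l' := by
  have hds := hθ.toIsMeasurableDS
  have : SecondCountableTopology X := UniformSpace.secondCountable_of_separable X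
  have hi := (isInvariantSet_iff hds).1 h.invariant
  have hi' : ∀ t ω, θ t ω ∈ Ω' ↔ ω ∈ Ω' := fun t ω => by
    have := (isInvariantSet_iff hds.reverse).1 h'.invariant (-t) ω
    rwa [reverseDS, neg_neg] at this
  -- the pairing, set to zero off the sets where the Floquet vectors are meaningful
  set c : Ω → ℝ := fun ω => (Ω'.indicator w' ω) (Ω₁.indicator w ω) with hc
  have hcm : Measurable c := by
    have h1 : Measurable fun p : StrongDual ℝ X × X => p.1 p.2 :=
      isBoundedBilinearMap_apply.continuous.measurable
    exact h1.comp ((measurable_indicator_of_subtype h'.measurableSet h'.measurable).prodMk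
      (measurable_indicator_of_subtype h.measurableSet h.measurable))
  have hcpos : ∀ ω ∈ Ω₁, ω ∈ Ω' → 0 < c ω := fun ω hω hω' => by
    simp only [hc, indicator_of_mem hω, indicator_of_mem hω']
    exact coneComponent_dual_apply_pos he hpos (h.mem_component ω hω) (h'.mem_component ω hω')
  have hcle : ∀ ω ∈ Ω₁, ω ∈ Ω' → c ω ≤ 1 := fun ω hω hω' => by
    simp only [hc, indicator_of_mem hω, indicator_of_mem hω']
    have := (w' ω).le_opNorm (w ω)
    rw [h.norm_eq_one ω hω, h'.norm_eq_one ω hω', one_mul] at this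
    exact (le_abs_self _).trans this
  have hrec : ∀ᵐ ω ∂P, ∀ m : ℕ, 1 / (m + 1 : ℝ) < c ω →
      ∃ᶠ n : ℕ in atTop, 1 / (m + 1 : ℝ) < c (θ (natTime 𝕋 n : 𝕋) ω) := by
    refine ae_all_iff.2 fun m => ?_
    filter_upwards [(hθ.measurePreserving
      (timeOne 𝕋 : 𝕋)).conservative.ae_mem_imp_frequently_image_mem
      (s := {ω | 1 / (m + 1 : ℝ) < c ω})
      (measurableSet_lt measurable_const hcm).nullMeasurableSet] with ω hω hωm
    refine (hω hωm).mono fun n hn => ?_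
    rw [hds.iterate] at hn
    exact hn
  obtain ⟨ω, hωr, hω, hω'⟩ : ∃ ω, (∀ m : ℕ, 1 / (m + 1 : ℝ) < c ω →
      ∃ᶠ n : ℕ in atTop, 1 / (m + 1 : ℝ) < c (θ (natTime 𝕋 n : 𝕋) ω)) ∧ ω ∈ Ω₁ ∧ ω ∈ Ω' :=
    (hrec.and (Eventually.and ((mem_ae_iff_prob_eq_one h.measurableSet).2 h.measure_eq_one)
      ((mem_ae_iff_prob_eq_one h'.measurableSet).2 h'.measure_eq_one))).exists
  obtain ⟨m, hm⟩ := exists_nat_one_div_lt (hcpos ω hω hω')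
  obtain ⟨k, hk, hkc⟩ := extraction_of_frequently_atTop (hωr m hm)
  have hkten := hk.tendsto_atTop
  set a : ℕ → ℝ := fun n => 1 / (n : ℝ) * Real.log ‖U ω (natTime 𝕋 n) (w ω)‖ with ha
  set b : ℕ → ℝ := fun n => 1 / (n : ℝ) * Real.log ‖dualSystem θ U (θ (natTime 𝕋 n : 𝕋) ω)
    (natTime 𝕋 n) (w' (θ (natTime 𝕋 n : 𝕋) ω))‖ with hb
  have haten : Tendsto (fun n => (a n : EReal)) atTop (𝓝 l) := by
    refine ((h.tendsto_atTop ω hω).comp tendsto_natTime_atTop).congr fun n => ?_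
    simp only [Function.comp_apply, ha, coe_natTime]
    rw [floquetGrowth, dif_pos (natTime 𝕋 n).2]
  have hbten : Tendsto (fun n => (b n : EReal)) atTop (𝓝 l') := by
    refine ((h'.tendsto_atBot ω hω').comp
      (tendsto_neg_atTop_atBot.comp tendsto_natTime_atTop)).congr' ?_
    filter_upwards [eventually_ge_atTop 1] with n hn
    have hneg : ¬ (0 : 𝕋) ≤ -(natTime 𝕋 n : 𝕋) := by
      rw [not_le, neg_lt_zero]
      exact Subtype.coe_lt_coe.mp (by
        rw [coe_natTime]; exact Nat.cast_pos.2 hn)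
    have h1 : reverseDS θ (-(natTime 𝕋 n : 𝕋)) ω = θ (natTime 𝕋 n : 𝕋) ω := by
      rw [reverseDS, neg_neg]
    have h2 : negTime hneg = natTime 𝕋 n := Subtype.ext (neg_neg _)
    simp only [Function.comp_apply, hb]
    rw [floquetGrowth, dif_neg hneg, h1, h2, one_div (‖_‖), Real.log_inv, AddSubgroup.coe_neg,
      coe_natTime]
    congr 1
    ring
  have hsub : ∀ n, a n = b n + 1 / (n : ℝ) * (Real.log (c ω) -
      Real.log (c (θ (natTime 𝕋 n : 𝕋) ω))) := by
    intro n
    have hωn := (hi (natTime 𝕋 n : 𝕋) ω).2 hω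
    have hωn' := (hi' (natTime 𝕋 n : 𝕋) ω).2 hω'
    have h1 := h.norm_mul_pairing_eq hds h' hω hω' (natTime 𝕋 n)
    have h2 := hcpos _ hωn hωn'
    have h3 := hcpos _ hω hω'
    simp only [hc, indicator_of_mem hω, indicator_of_mem hω', indicator_of_mem hωn,
      indicator_of_mem hωn'] at h2 h3 ⊢
    have h4 := congrArg Real.log h1
    rw [Real.log_mul (norm_ne_zero_iff.2 (h.normalized ω hω _).1) h2.ne',
      Real.log_mul (norm_ne_zero_iff.2 (h'.normalized _ hωn' _).1) h3.ne'] at h4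
    simp only [ha, hb]
    rw [← mul_add]
    congr 1
    linarith
  have hd : Tendsto (fun j => 1 / (k j : ℝ) * (Real.log (c ω) -
      Real.log (c (θ (natTime 𝕋 (k j) : 𝕋) ω)))) atTop (𝓝 0) := by
    have h1 : Tendsto (fun j => 1 / (k j : ℝ)) atTop (𝓝 0) :=
      tendsto_one_div_atTop_nhds_zero_nat.comp hkten
    refine h1.zero_mul_isBoundedUnder_le (isBoundedUnder_of
      ⟨|Real.log (c ω)| + |Real.log (1 / (m + 1 : ℝ))|, fun j => ?_⟩)
    simp only [Function.comp_apply, Real.norm_eq_abs]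
    refine (abs_sub _ _).trans (add_le_add le_rfl ?_)
    have h2 := hkc j
    have h3 := hcle _ ((hi (natTime 𝕋 (k j) : 𝕋) ω).2 hω) ((hi' (natTime 𝕋 (k j) : 𝕋) ω).2 hω')
    have h4 : (0 : ℝ) < 1 / (m + 1 : ℝ) := by positivity
    have h5 := Real.log_le_log h4 h2.le
    have h6 := Real.log_nonpos (h4.trans h2).le h3
    rw [abs_of_nonpos h6, abs_of_nonpos (h5.trans h6)]
    linarith
  refine tendsto_nhds_unique (haten.comp hkten) ?_
  have hadd : Tendsto (fun j => (b (k j) : EReal) + ((1 / (k j : ℝ) * (Real.log (c ω) -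
      Real.log (c (θ (natTime 𝕋 (k j) : 𝕋) ω))) : ℝ) : EReal)) atTop
      (𝓝 (l' + ((0 : ℝ) : EReal))) := by
    refine (EReal.continuousAt_add (Or.inr ?_) (Or.inr ?_)).tendsto.comp
      ((hbten.comp hkten).prodMk_nhds ((continuous_coe_real_ereal.tendsto 0).comp hd)) <;> simp
  rw [EReal.coe_zero, add_zero] at hadd
  refine hadd.congr fun j => ?_
  rw [Function.comp_apply, hsub (k j), EReal.coe_add]

end Duality

theorem mainTheorem4
    {𝕋 : AddSubgroup ℝ} [IsTimeSet 𝕋]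
    {Ω : Type*} [MeasurableSpace Ω] (P : Measure Ω) [IsProbabilityMeasure P]
    {X : Type*} [NormedAddCommGroup X] [NormedSpace ℝ X] [CompleteSpace X]
    [MeasurableSpace X] [BorelSpace X]
    (θ : 𝕋 → Ω → Ω) (U : Ω → NonnegTime 𝕋 → (X →L[ℝ] X)) (hU : IsMLSPS θ U)
    (K : Set X) (hK : IsCone K)
    (hA0 : NormallyOrderedSeparable (dualCone K))
    (hA1 : IntegrableSystem P (reverseDS θ) (dualSystem θ U))
    (hA2 : PositiveSystem P (reverseDS θ) (dualSystem θ U) (dualCone K))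
    (e' : StrongDual ℝ X)
    (hA3 : FocusingSystem P (reverseDS θ) (dualSystem θ U) (dualCone K) e') :
    ∃ (Ω' : Set Ω) (w' : Ω → StrongDual ℝ X) (l' : EReal),
      IsPrincipalFloquet P (reverseDS θ) (dualSystem θ U) (dualCone K) e' Ω' w' l' ∧
      ∀ e : X, NormallyOrderedSeparable K → IntegrableSystem P θ U →
        PositiveSystem P θ U K → FocusingSystem P θ U K e →
        (∃ (Ω₁ : Set Ω) (w : Ω → X) (l : EReal), IsPrincipalFloquet P θ U K e Ω₁ w l) ∧
        ∀ (Ω₁ : Set Ω) (w : Ω → X) (l : EReal),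
          IsPrincipalFloquet P θ U K e Ω₁ w l → l = l' := by
  obtain ⟨Ω', w', l', h'⟩ := hA3.exists_isPrincipalFloquet hA0.normal hA1
  refine ⟨Ω', w', l', h', fun e hn hI hP hF => ⟨hF.exists_isPrincipalFloquet hn.normal hI,
    fun Ω₁ w l h => ?_⟩⟩
  have := hn.separable
  have : Nonempty Ω := nonempty_of_isProbabilityMeasure P
  exact h.exponent_eq hP.ergodic h' hA3.e_mem (hF.dual_apply_pos hA3)
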